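/- Let $M$ be a compact smooth manifold (Hausdorff, without boundary) of dimension $2n+1$, $n\ge 0$, with a cosymplectic structure $(\eta,\omega)$: $\eta$ is a closed $1$-form and $\omega$ a closed $2$-form on $M$ such that $\eta\wedge\omega^n$ vanishes nowhere. Let $R$ be its Reeb vector field, determined by $\iota_R\eta=1$ and $\iota_R\omega=0$. Let a torus $T=(S^1)^m$, $m\ge 0$, act smoothly on $M$ by cosymplectomorphisms, i.e. $g^*\eta=\eta$ and $g^*\omega=\omega$ for all $g\in T$. A smooth differential form $\alpha$ on $M$ is called $R$-basic if $\iota_R\alpha=0$ and $\iota_R d\alpha=0$ (equivalently, $\iota_R\alpha=0$ and $L_R\alpha=0$); with the exterior derivative and the wedge product, the $R$-basic forms constitute a differential graded subalgebra $\Omega(M,\mathcal F_R)$ of the de Rham algebra $\Omega(M)$, and the $R$-basic forms $\alpha$ with $g^*\alpha=\alpha$ for all $g\in T$ constitute a differential graded subalgebra $\Omega(M,\mathcal F_R)^T$ of $\Omega(M,\mathcal F_R)$. Then the inclusion $\Omega(M,\mathcal F_R)^T\to\Omega(M,\mathcal F_R)$ is a quasi-isomorphism of differential graded algebras, i.e.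 it is a morphism of differential graded algebras that induces an isomorphism in cohomology in every degree. -/

import Mathlib

open scoped Manifold ContDiff Nat

section LinAlg
variable {V : Type*} [AddCommGroup V] [Module ℝ V] [TopologicalSpace V]

/-- The first `p` of `n = p + q` indices. -/
def idxL {p q n : ℕ} (h : p + q = n) (i : Fin p) : Fin n := Fin.cast h (Fin.castAdd q i)
/-- The last `q` of `n = p + q` indices. -/
def idxR {p q n : ℕ} (h : p + q = n) (j : Fin q) : Fin n := Fin.cast h (Fin.natAdd p j)

/-- `(a ⊗ b)(v₁, …, vₙ) = a(v₁, …, v_p) b(v_{p+1}, …, v_n)`, where `n = p + q`. -/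
noncomputable def tensorForm {p q n : ℕ} (h : p + q = n) (a : V [⋀^Fin p]→L[ℝ] ℝ)
    (b : V [⋀^Fin q]→L[ℝ] ℝ) : ContinuousMultilinearMap ℝ (fun _ : Fin n => V) ℝ where
  toMultilinearMap := (LinearMap.mul' ℝ ℝ).compMultilinearMap
    ((MultilinearMap.domCoprod (a.toAlternatingMap : MultilinearMap ℝ (fun _ => V) ℝ)
      (b.toAlternatingMap : MultilinearMap ℝ (fun _ => V) ℝ)).domDomCongr
        (finSumFinEquiv.trans (finCongr h)))
  cont := by
    have : Continuous fun v : Fin n → V => a (v ∘ idxL h) * b (v ∘ idxR h) := by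
      refine (a.cont.comp ?_).mul (b.cont.comp ?_) <;> fun_prop
    exact this

theorem tensorForm_apply {p q n : ℕ} (h : p + q = n) (a : V [⋀^Fin p]→L[ℝ] ℝ)
    (b : V [⋀^Fin q]→L[ℝ] ℝ) (v : Fin n → V) :
    tensorForm h a b v = a (v ∘ idxL h) * b (v ∘ idxR h) := rfl

/-- The wedge product of alternating forms (determinant convention), `n = p + q`:
`(a ∧ b)(v) = 1 / (p! q!) ∑_σ sign(σ) a(v_{σ 1}, …, v_{σ p}) b(v_{σ(p+1)}, …, v_{σ n})`. -/
noncomputable def wedgeAlt {p q n : ℕ} (h : p + q = n) (a : V [⋀^Fin p]→L[ℝ] ℝ)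
    (b : V [⋀^Fin q]→L[ℝ] ℝ) : V [⋀^Fin n]→L[ℝ] ℝ :=
  ((p ! * q ! : ℝ)⁻¹) • (tensorForm h a b).alternatization

/-- The signed sum of `f` over all permutations of its arguments. -/
noncomputable def altSum {X : Type*} {n : ℕ} (f : (Fin n → X) → ℝ) (v : Fin n → X) : ℝ :=
  ∑ σ : Equiv.Perm (Fin n), (Equiv.Perm.sign σ : ℝ) * f (v ∘ σ)

theorem wedge_apply {p q n : ℕ} (h : p + q = n) (a : V [⋀^Fin p]→L[ℝ] ℝ)
    (b : V [⋀^Fin q]→L[ℝ] ℝ) (v : Fin n → V) :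
    wedgeAlt h a b v = (p ! * q ! : ℝ)⁻¹ * altSum (fun w => a (w ∘ idxL h) * b (w ∘ idxR h)) v := by
  simp only [wedgeAlt, ContinuousAlternatingMap.smul_apply, smul_eq_mul, altSum]
  rw [ContinuousMultilinearMap.alternatization_apply_apply]
  simp only [Units.smul_def, zsmul_eq_mul]
  rfl

theorem altSum_comp {X : Type*} {n : ℕ} (f : (Fin n → X) → ℝ) (τ : Equiv.Perm (Fin n)) (v : Fin n → X) :
    altSum (fun w => f (w ∘ τ)) v = (Equiv.Perm.sign τ : ℝ) * altSum f v := by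
  unfold altSum
  rw [Finset.mul_sum, ← Equiv.sum_comp (Equiv.mulRight τ)]
  conv_rhs => rw [← Equiv.sum_comp (Equiv.mulRight τ)]
  conv_lhs => rw [Equiv.sum_comp (Equiv.mulRight τ)
    (fun σ => (Equiv.Perm.sign σ : ℝ) * f ((v ∘ σ) ∘ τ))]
  refine Finset.sum_congr rfl fun σ _ => ?_
  have : ((Equiv.Perm.sign τ : ℤ) : ℝ) * (Equiv.Perm.sign τ : ℤ) = 1 := by
    rw [← Int.cast_mul, ← Units.val_mul, Int.units_mul_self]; simp
  simp only [Equiv.coe_mulRight, Equiv.Perm.sign_mul, Units.val_mul, Int.cast_mul,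
    Equiv.Perm.coe_mul, Function.comp_assoc]
  linear_combination (-((Equiv.Perm.sign σ : ℤ) : ℝ) * f (v ∘ ⇑σ ∘ ⇑τ)) * this

theorem altSum_alternating {n : ℕ} (a : V [⋀^Fin n]→L[ℝ] ℝ) (v : Fin n → V) :
    altSum a v = n ! * a v := by
  have h : ∀ σ : Equiv.Perm (Fin n), (Equiv.Perm.sign σ : ℝ) * a (v ∘ σ) = a v := by
    intro σ
    have := a.toAlternatingMap.map_perm v σ
    simp only [ContinuousAlternatingMap.coe_toAlternatingMap, Units.smul_def, zsmul_eq_mul] at this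
    rw [this, ← mul_assoc, ← Int.cast_mul, ← Units.val_mul, Int.units_mul_self]; simp
  simp [altSum, h, Fintype.card_perm]

theorem altSum_smul {X : Type*} {n : ℕ} (c : ℝ) (f : (Fin n → X) → ℝ) (v : Fin n → X) :
    altSum (fun w => c * f w) v = c * altSum f v := by
  simp only [altSum, Finset.mul_sum]
  exact Finset.sum_congr rfl fun _ _ => by ring

theorem altSum_sum {X : Type*} {n : ℕ} {ι : Type*} (s : Finset ι) (f : ι → (Fin n → X) → ℝ) (v : Fin n → X) :
    altSum (fun w => ∑ i ∈ s, f i w) v = ∑ i ∈ s, altSum (f i) v := by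
  simp only [altSum, Finset.mul_sum]
  exact Finset.sum_comm

theorem sign_viaEmbedding' {α β : Type*} [Fintype α] [DecidableEq α] [Fintype β] [DecidableEq β]
    (τ : Equiv.Perm α) (j : α ↪ β) : Equiv.Perm.sign (τ.viaEmbedding j) = Equiv.Perm.sign τ := by
  unfold Equiv.Perm.viaEmbedding
  convert! Equiv.Perm.sign_extendDomain τ (Equiv.ofInjective j.1 j.2)

theorem altSum_partial {X : Type*} {p n : ℕ} (j : Fin p ↪ Fin n) (G : (Fin n → X) → ℝ) (v : Fin n → X) :
    altSum (fun w => ∑ τ : Equiv.Perm (Fin p),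
      (Equiv.Perm.sign τ : ℝ) * G (w ∘ τ.viaEmbedding j)) v = p ! * altSum G v := by
  rw [altSum_sum]
  have : ∀ τ : Equiv.Perm (Fin p), altSum (fun w => (Equiv.Perm.sign τ : ℝ) *
      G (w ∘ τ.viaEmbedding j)) v = altSum G v := by
    intro τ
    rw [altSum_smul, altSum_comp, sign_viaEmbedding', ← mul_assoc, ← Int.cast_mul,
      ← Units.val_mul, Int.units_mul_self]
    simp
  simp [this, Fintype.card_perm]

theorem altSum_left {X : Type*} {p q n : ℕ} (h : p + q = n) (u : (Fin p → X) → ℝ) (b : (Fin q → X) → ℝ)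
    (v : Fin n → X) :
    altSum (fun w => altSum u (w ∘ idxL h) * b (w ∘ idxR h)) v =
      p ! * altSum (fun w => u (w ∘ idxL h) * b (w ∘ idxR h)) v := by
  subst h
  rw [← altSum_partial (Fin.castAddEmb q)]
  congr 1; ext w
  rw [altSum, Finset.sum_mul]
  refine Finset.sum_congr rfl fun τ _ => ?_
  rw [mul_assoc]
  congr 3
  · ext i
    exact congrArg w (Equiv.Perm.viaEmbedding_apply τ (Fin.castAddEmb q) i).symm
  · ext i
    refine congrArg w (Equiv.Perm.viaEmbedding_apply_of_notMem τ (Fin.castAddEmb q) _ ?_).symm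
    rintro ⟨k, hk⟩
    have := congrArg Fin.val hk
    simp [idxR] at this
    omega

theorem altSum_right {X : Type*} {p q n : ℕ} (h : p + q = n) (a : (Fin p → X) → ℝ) (u : (Fin q → X) → ℝ)
    (v : Fin n → X) :
    altSum (fun w => a (w ∘ idxL h) * altSum u (w ∘ idxR h)) v =
      q ! * altSum (fun w => a (w ∘ idxL h) * u (w ∘ idxR h)) v := by
  subst h
  rw [← altSum_partial (Fin.natAddEmb p)]
  congr 1; ext w
  rw [altSum, Finset.mul_sum]
  refine Finset.sum_congr rfl fun τ _ => ?_
  rw [mul_left_comm]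
  congr 3
  · ext i
    refine congrArg w (Equiv.Perm.viaEmbedding_apply_of_notMem τ (Fin.natAddEmb p) _ ?_).symm
    rintro ⟨k, hk⟩
    have := congrArg Fin.val hk
    simp [idxL] at this
    omega
  · ext i
    exact congrArg w (Equiv.Perm.viaEmbedding_apply τ (Fin.natAddEmb p) i).symm

theorem wedge_assoc {p q r m k n : ℕ} (h₁ : p + q = m) (h₂ : m + r = n) (h₃ : q + r = k)
    (h₄ : p + k = n) (a : V [⋀^Fin p]→L[ℝ] ℝ) (b : V [⋀^Fin q]→L[ℝ] ℝ) (c : V [⋀^Fin r]→L[ℝ] ℝ) :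
    wedgeAlt h₂ (wedgeAlt h₁ a b) c = wedgeAlt h₄ a (wedgeAlt h₃ b c) := by
  ext v
  simp only [wedge_apply]
  have e1 := altSum_left h₂ (fun w => a (w ∘ idxL h₁) * b (w ∘ idxR h₁)) c v
  have e2 := altSum_right h₄ a (fun w => b (w ∘ idxL h₃) * c (w ∘ idxR h₃)) v
  simp only [mul_assoc ((p ! * q ! : ℝ)⁻¹), mul_left_comm _ ((q ! * r ! : ℝ)⁻¹), altSum_smul]
  rw [e1, e2]
  have e3 : (fun w : Fin n → V => a ((w ∘ idxL h₂) ∘ idxL h₁) * b ((w ∘ idxL h₂) ∘ idxR h₁) *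
      c (w ∘ idxR h₂)) = fun w => a (w ∘ idxL h₄) *
        (b ((w ∘ idxR h₄) ∘ idxL h₃) * c ((w ∘ idxR h₄) ∘ idxR h₃)) := by
    subst h₁ h₃ h₂
    ext w
    rw [mul_assoc]
    refine congrArg₂ _ (congrArg a ?_) (congrArg₂ _ (congrArg b ?_) (congrArg c ?_))
    all_goals
      funext i
      refine congrArg w (Fin.ext ?_)
      simp [idxL, idxR, Nat.add_assoc]
  rw [e3]
  have := Nat.factorial_ne_zero m
  have := Nat.factorial_ne_zero k
  field_simp

theorem one_wedge {q n : ℕ} (h : 0 + q = n) (h' : q = n) (b : V [⋀^Fin q]→L[ℝ] ℝ) (v : Fin n → V) :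
    wedgeAlt h (ContinuousAlternatingMap.constOfIsEmpty ℝ V (Fin 0) 1) b v =
      b (v ∘ Fin.cast h') := by
  subst h'
  rw [wedge_apply]
  have : (fun w : Fin q → V => (ContinuousAlternatingMap.constOfIsEmpty ℝ V (Fin 0) (1:ℝ))
      (w ∘ idxL h) * b (w ∘ idxR h)) = b := by
    ext w
    simp only [ContinuousAlternatingMap.constOfIsEmpty_apply, one_mul]
    congr 1; ext i; refine congrArg w (Fin.ext ?_); simp [idxR]
  rw [this, altSum_alternating]
  have := Nat.factorial_ne_zero q
  simp; field_simp

theorem wedge_one {p n : ℕ} (h : p + 0 = n) (h' : p = n) (a : V [⋀^Fin p]→L[ℝ] ℝ) (v : Fin n → V) :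
    wedgeAlt h a (ContinuousAlternatingMap.constOfIsEmpty ℝ V (Fin 0) 1) v =
      a (v ∘ Fin.cast h') := by
  subst h'
  rw [wedge_apply]
  have : (fun w : Fin p → V => a (w ∘ idxL h) *
      (ContinuousAlternatingMap.constOfIsEmpty ℝ V (Fin 0) (1:ℝ)) (w ∘ idxR h)) = a := by
    ext w
    simp only [ContinuousAlternatingMap.constOfIsEmpty_apply, mul_one]
    congr 1
  rw [this, altSum_alternating]
  have := Nat.factorial_ne_zero p
  simp; field_simp

theorem wedge_add_left {p q n : ℕ} (h : p + q = n) (a a' : V [⋀^Fin p]→L[ℝ] ℝ)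
    (b : V [⋀^Fin q]→L[ℝ] ℝ) : wedgeAlt h (a + a') b = wedgeAlt h a b + wedgeAlt h a' b := by
  ext v
  simp only [wedge_apply, ContinuousAlternatingMap.add_apply, altSum, add_mul, mul_add,
    Finset.sum_add_distrib]

theorem wedge_add_right {p q n : ℕ} (h : p + q = n) (a : V [⋀^Fin p]→L[ℝ] ℝ)
    (b b' : V [⋀^Fin q]→L[ℝ] ℝ) : wedgeAlt h a (b + b') = wedgeAlt h a b + wedgeAlt h a b' := by
  ext v
  simp only [wedge_apply, ContinuousAlternatingMap.add_apply, altSum, mul_add,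
    Finset.sum_add_distrib]

theorem wedge_smul_left {p q n : ℕ} (h : p + q = n) (c : ℝ) (a : V [⋀^Fin p]→L[ℝ] ℝ)
    (b : V [⋀^Fin q]→L[ℝ] ℝ) : wedgeAlt h (c • a) b = c • wedgeAlt h a b := by
  ext v
  simp only [wedge_apply, ContinuousAlternatingMap.smul_apply, smul_eq_mul, altSum,
    Finset.mul_sum]
  exact Finset.sum_congr rfl fun _ _ => by ring

theorem wedge_smul_right {p q n : ℕ} (h : p + q = n) (c : ℝ) (a : V [⋀^Fin p]→L[ℝ] ℝ)
    (b : V [⋀^Fin q]→L[ℝ] ℝ) : wedgeAlt h a (c • b) = c • wedgeAlt h a b := by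
  ext v
  simp only [wedge_apply, ContinuousAlternatingMap.smul_apply, smul_eq_mul, altSum,
    Finset.mul_sum]
  exact Finset.sum_congr rfl fun _ _ => by ring

theorem wedge_comp {W : Type*} [AddCommGroup W] [Module ℝ W] [TopologicalSpace W]
    {p q n : ℕ} (h : p + q = n) (a : V [⋀^Fin p]→L[ℝ] ℝ) (b : V [⋀^Fin q]→L[ℝ] ℝ) (f : W →L[ℝ] V) :
    wedgeAlt h (a.compContinuousLinearMap f) (b.compContinuousLinearMap f) =
      (wedgeAlt h a b).compContinuousLinearMap f := by
  ext v
  simp only [wedge_apply, ContinuousAlternatingMap.compContinuousLinearMap_apply, altSum]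
  rfl

theorem wedge_eq_zero_of_mem {p q n : ℕ} (h : p + q = n) (a : V [⋀^Fin p]→L[ℝ] ℝ)
    (b : V [⋀^Fin q]→L[ℝ] ℝ) (x : V) (ha : ∀ v i, v i = x → a v = 0) (hb : ∀ v i, v i = x → b v = 0)
    (v : Fin n → V) (i : Fin n) (hi : v i = x) : wedgeAlt h a b v = 0 := by
  subst h
  rw [wedge_apply, altSum, Finset.sum_eq_zero, mul_zero]
  intro σ _
  obtain ⟨j, hj⟩ := σ.surjective i
  subst hj
  induction j using Fin.addCases with
  | left j => rw [ha _ j (hi : v (σ (Fin.castAdd q j)) = x), zero_mul, mul_zero]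
  | right j => rw [hb _ j (hi : v (σ (Fin.natAdd p j)) = x), mul_zero, mul_zero]

end LinAlg
section Leib
variable {E : Type*} [NormedAddCommGroup E] [NormedSpace ℝ E]
open ContinuousAlternatingMap

theorem altSum_uncurry {n : ℕ} (f : E →L[ℝ] E [⋀^Fin n]→L[ℝ] ℝ) (v : Fin (n + 1) → E) :
    altSum (fun w => f (w 0) (Fin.tail w)) v = n ! * alternatizeUncurryFin f v := by
  have h1 := altSum_alternating (alternatizeUncurryFin f) v
  have h2 : altSum (alternatizeUncurryFin f) v =
      (n + 1) * altSum (fun w => f (w 0) (Fin.tail w)) v := by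
    have : (alternatizeUncurryFin f : (Fin (n+1) → E) → ℝ) = fun w =>
        ∑ i : Fin (n + 1), (-1 : ℝ) ^ (i : ℕ) * (fun w => f (w 0) (Fin.tail w))
          (w ∘ (Fin.cycleRange i).symm) := by
      ext w
      rw [alternatizeUncurryFin_apply]
      refine Finset.sum_congr rfl fun i _ => ?_
      have e : Fin.tail (w ∘ (Fin.cycleRange i).symm) = i.removeNth w := by
        ext j
        simp [Fin.tail, Fin.removeNth]
      simp [e]
    rw [this, altSum_sum]
    have : ∀ i : Fin (n + 1), altSum (fun w => (-1 : ℝ) ^ (i : ℕ) *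
        (fun w => f (w 0) (Fin.tail w)) (w ∘ (Fin.cycleRange i).symm)) v =
        altSum (fun w => f (w 0) (Fin.tail w)) v := by
      intro i
      rw [altSum_smul, altSum_comp (fun w : Fin (n + 1) → E => f (w 0) (Fin.tail w)),
        Equiv.Perm.sign_symm, Fin.sign_cycleRange, ← mul_assoc]
      simp [← mul_pow]
    rw [Finset.sum_congr rfl fun i _ => this i]
    simp
  rw [h2, Nat.factorial_succ] at h1
  have : (n + 1 : ℝ) ≠ 0 := by positivity
  apply mul_left_cancel₀ this
  rw [h1]; push_cast; ring

/-- The wedge product as a continuous bilinear map. -/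
noncomputable def wedgeCLM {p q n : ℕ} (h : p + q = n) :
    (E [⋀^Fin p]→L[ℝ] ℝ) →L[ℝ] (E [⋀^Fin q]→L[ℝ] ℝ) →L[ℝ] (E [⋀^Fin n]→L[ℝ] ℝ) :=
  LinearMap.mkContinuous₂ (LinearMap.mk₂ ℝ (wedgeAlt h) (wedge_add_left h) (wedge_smul_left h)
    (wedge_add_right h) (wedge_smul_right h)) ((p ! * q ! : ℝ)⁻¹ * n !) (by
      intro a b
      refine ContinuousAlternatingMap.opNorm_le_bound _ (by positivity) fun v => ?_
      simp only [LinearMap.mk₂_apply, wedge_apply]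
      rw [norm_mul, Real.norm_of_nonneg (by positivity : (0:ℝ) ≤ (p ! * q ! : ℝ)⁻¹)]
      simp only [mul_assoc]
      refine mul_le_mul_of_nonneg_left ?_ (by positivity)
      have key : ∀ σ : Equiv.Perm (Fin n), ‖(Equiv.Perm.sign σ : ℝ) *
          (a ((v ∘ σ) ∘ idxL h) * b ((v ∘ σ) ∘ idxR h))‖ ≤ ‖a‖ * (‖b‖ * ∏ i, ‖v i‖) := by
        intro σ
        have hs : ‖((Equiv.Perm.sign σ : ℤ) : ℝ)‖ = 1 := by
          rcases Int.units_eq_one_or (Equiv.Perm.sign σ) with h | h <;> simp [h]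
        rw [norm_mul, hs, one_mul, norm_mul, ← Equiv.prod_comp σ]
        subst h
        rw [Fin.prod_univ_add]
        calc _ ≤ (‖a‖ * ∏ i, ‖v (σ (Fin.castAdd q i))‖) * (‖b‖ * ∏ i, ‖v (σ (Fin.natAdd p i))‖) :=
              mul_le_mul (a.le_opNorm _) (b.le_opNorm _) (norm_nonneg _) (by positivity)
          _ = _ := by ring
      refine (norm_sum_le _ _).trans ((Finset.sum_le_sum fun σ _ => key σ).trans ?_)
      simp [Fintype.card_perm])

@[simp] theorem wedgeCLM_apply {p q n : ℕ} (h : p + q = n) (a : E [⋀^Fin p]→L[ℝ] ℝ)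
    (b : E [⋀^Fin q]→L[ℝ] ℝ) : wedgeCLM h a b = wedgeAlt h a b := rfl

theorem uncurry_wedge_aux {n : ℕ} (F : E →L[ℝ] E [⋀^Fin n]→L[ℝ] ℝ) (c : ℝ)
    (G : E → (Fin n → E) → ℝ) (hF : ∀ x w, F x w = c * altSum (G x) w) (v : Fin (n + 1) → E) :
    alternatizeUncurryFin F v = c * altSum (fun w => G (w 0) (Fin.tail w)) v := by
  have h1 := altSum_uncurry F v
  simp only [hF, altSum_smul] at h1
  have h2 : altSum (fun w : Fin (n+1) → E => altSum (G (w 0)) (Fin.tail w)) v =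
      n ! * altSum (fun w => G (w 0) (Fin.tail w)) v := by
    rw [← altSum_partial (Fin.succEmb n)]
    congr 1; ext w
    refine Finset.sum_congr rfl fun τ _ => ?_
    congr 1
    have e0 : τ.viaEmbedding (Fin.succEmb n) 0 = 0 :=
      Equiv.Perm.viaEmbedding_apply_of_notMem _ _ _ (by rintro ⟨k, hk⟩; exact Fin.succ_ne_zero k hk)
    have e1 : Fin.tail w ∘ τ = Fin.tail (w ∘ τ.viaEmbedding (Fin.succEmb n)) := by
      ext i
      exact congrArg w (Equiv.Perm.viaEmbedding_apply τ (Fin.succEmb n) i).symm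
    rw [e1]; simp [e0]
  rw [h2] at h1
  have : (n ! : ℝ) ≠ 0 := by positivity
  apply mul_left_cancel₀ this
  rw [← h1]; ring

theorem uncurry_wedge_left {p q n : ℕ} (h : p + q = n) (h' : p + 1 + q = n + 1)
    (A : E →L[ℝ] E [⋀^Fin p]→L[ℝ] ℝ) (b : E [⋀^Fin q]→L[ℝ] ℝ) :
    alternatizeUncurryFin ((wedgeCLM h).flip b ∘L A) = wedgeAlt h' (alternatizeUncurryFin A) b := by
  ext v
  rw [uncurry_wedge_aux _ ((p ! * q ! : ℝ)⁻¹) (fun x w => A x (w ∘ idxL h) * b (w ∘ idxR h))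
    (fun x w => wedge_apply h (A x) b w), wedge_apply]
  have e1 := altSum_left h' (fun w => A (w 0) (Fin.tail w)) b v
  simp only [altSum_uncurry, mul_assoc, altSum_smul] at e1
  have e3 : (fun w : Fin (n+1) → E => A (w 0) (Fin.tail w ∘ idxL h) * b (Fin.tail w ∘ idxR h)) =
      fun w => A ((w ∘ idxL h') 0) (Fin.tail (w ∘ idxL h')) * b (w ∘ idxR h') := by
    subst h
    ext w
    refine congrArg₂ _ (congrArg₂ (fun (x : E) z => A x z) (congrArg w ?_) ?_) (congrArg b ?_)
    · apply Fin.ext; simp [idxL]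
    all_goals
      funext i
      refine congrArg w (Fin.ext ?_)
      simp [idxL, idxR]
    omega
  rw [e3]
  have : (p ! : ℝ) ≠ 0 := by positivity
  have h1 : ((p+1)! : ℝ) ≠ 0 := by positivity
  have h2 : (q ! : ℝ) ≠ 0 := by positivity
  field_simp
  linear_combination -e1

theorem uncurry_wedge_right {p q n : ℕ} (h : p + q = n) (h' : p + (q + 1) = n + 1)
    (a : E [⋀^Fin p]→L[ℝ] ℝ) (B : E →L[ℝ] E [⋀^Fin q]→L[ℝ] ℝ) :
    alternatizeUncurryFin (wedgeCLM h a ∘L B) =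
      (-1 : ℝ) ^ p • wedgeAlt h' a (alternatizeUncurryFin B) := by
  ext v
  rw [uncurry_wedge_aux _ ((p ! * q ! : ℝ)⁻¹) (fun x w => a (w ∘ idxL h) * B x (w ∘ idxR h))
    (fun x w => wedge_apply h a (B x) w), ContinuousAlternatingMap.smul_apply, wedge_apply]
  have e1 := altSum_right h' a (fun w => B (w 0) (Fin.tail w)) v
  simp only [altSum_uncurry, mul_left_comm _ (q ! : ℝ), altSum_smul] at e1
  have hp : p < n + 1 := by omega
  have e2 := altSum_comp (fun w : Fin (n+1) → E => a (Fin.tail w ∘ idxL h) *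
    B (w 0) (Fin.tail w ∘ idxR h)) (Fin.cycleRange ⟨p, hp⟩).symm v
  rw [Equiv.Perm.sign_symm, Fin.sign_cycleRange] at e2
  have e3 : (fun w : Fin (n+1) → E => a (Fin.tail (w ∘ (Fin.cycleRange ⟨p, hp⟩).symm) ∘ idxL h) *
      B ((w ∘ (Fin.cycleRange ⟨p, hp⟩).symm) 0)
        (Fin.tail (w ∘ (Fin.cycleRange ⟨p, hp⟩).symm) ∘ idxR h)) =
      fun w => a (w ∘ idxL h') * B ((w ∘ idxR h') 0) (Fin.tail (w ∘ idxR h')) := by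
    subst h
    ext w
    have t : ∀ j : Fin (p+q), Fin.tail (w ∘ (Fin.cycleRange ⟨p, hp⟩).symm) j =
        w (Fin.succAbove ⟨p, hp⟩ j) := by
      intro j; simp [Fin.tail]
    congr 2
    · ext i
      rw [Function.comp_apply, t]
      refine congrArg w ?_
      rw [Fin.succAbove_of_castSucc_lt]
      · apply Fin.ext; simp [idxL]
      · simp [idxL, Fin.lt_def]
    · congr 1
      simp only [Function.comp_apply, Fin.cycleRange_symm_zero]
      congr 2
    · ext i
      rw [Function.comp_apply, t]
      refine congrArg w ?_
      rw [Fin.succAbove_of_le_castSucc]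
      · apply Fin.ext; simp [idxR]; omega
      · simp [idxR, Fin.le_def]
  simp only [e3] at e2
  rw [e2] at e1
  have h0 : (p ! : ℝ) ≠ 0 := by positivity
  have h1 : ((q+1)! : ℝ) ≠ 0 := by positivity
  have h2 : (q ! : ℝ) ≠ 0 := by positivity
  have hs : ((-1 : ℝ) ^ p) * (-1) ^ p = 1 := by simp [← mul_pow]
  push_cast at e1
  simp only [smul_eq_mul]
  field_simp
  linear_combination (-(-1:ℝ)^p) * e1 - (((q+1)! : ℝ) * altSum (fun w : Fin (n+1) → E => a (Fin.tail w ∘ idxL h) *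
    B (w 0) (Fin.tail w ∘ idxR h)) v) * hs

theorem extDeriv_wedge {p q n : ℕ} (h : p + q = n) (hl : p + 1 + q = n + 1)
    (hr : p + (q + 1) = n + 1) {a : E → E [⋀^Fin p]→L[ℝ] ℝ} {b : E → E [⋀^Fin q]→L[ℝ] ℝ} {x : E}
    (ha : DifferentiableAt ℝ a x) (hb : DifferentiableAt ℝ b x) :
    extDeriv (fun y => wedgeAlt h (a y) (b y)) x =
      wedgeAlt hl (extDeriv a x) (b x) + (-1 : ℝ) ^ p • wedgeAlt hr (a x) (extDeriv b x) := by
  have := (wedgeCLM (E := E) h).hasFDerivAt_of_bilinear ha.hasFDerivAt hb.hasFDerivAt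
  simp only [wedgeCLM_apply] at this
  rw [extDeriv, this.fderiv, alternatizeUncurryFin_add]
  exact (add_comm _ _).trans (congrArg₂ _ (uncurry_wedge_left h hl (fderiv ℝ a x) (b x))
    (uncurry_wedge_right h hr (a x) (fderiv ℝ b x)))
end Leib

section T
variable {E : Type*} [NormedAddCommGroup E] [NormedSpace ℝ E]
theorem contDiff_wedgeCLM {p q n : ℕ} (h : p + q = n) : ContDiff ℝ ∞ (wedgeCLM (E := E) h) := 
  by fun_prop
end T

section Forms
variable (E : Type*) [NormedAddCommGroup E] [NormedSpace ℝ E]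
  (M : Type*) [TopologicalSpace M] [ChartedSpace E M]

/-- A (not necessarily smooth) differential `k`-form on a manifold `M` modelled on `E`: an
alternating `k`-form on each tangent space. -/
abbrev FormField (k : ℕ) : Type _ := ∀ x : M, TangentSpace 𝓘(ℝ, E) x [⋀^Fin k]→L[ℝ] ℝ

variable {E M}
variable {F : Type*} [NormedAddCommGroup F] [NormedSpace ℝ F]
  {N : Type*} [TopologicalSpace N] [ChartedSpace F N]
namespace FormField

theorem two_le_infty : minSmoothness ℝ 2 ≤ (∞ : ℕ∞ω) := by
  rw [minSmoothness_of_isRCLikeNormedField]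
  exact WithTop.coe_le_coe.mpr le_top

/-- The pull-back `f^*α`. -/
noncomputable def pullback {k : ℕ} (f : N → M) (α : FormField E M k) : FormField F N k :=
  fun x => (α (f x)).compContinuousLinearMap (mfderiv 𝓘(ℝ, F) 𝓘(ℝ, E) f x)

/-- The representative of `α` in the preferred chart at `x₀`: its pull-back along the inverse of
the chart, a form on (the target of the chart in) `E`. -/
noncomputable def inChart {k : ℕ} (α : FormField E M k) (x₀ : M) : E → E [⋀^Fin k]→L[ℝ] ℝ :=
  pullback (F := E) (chartAt E x₀).symm α

/-- A form is smooth if its representatives in charts are. -/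
def IsSmooth {k : ℕ} (α : FormField E M k) : Prop :=
  ∀ x₀ : M, ContDiffOn ℝ ∞ (α.inChart x₀) (chartAt E x₀).target

/-- The exterior derivative, computed at `x` in the preferred chart at `x`. -/
noncomputable def extDer {k : ℕ} (α : FormField E M k) : FormField E M (k + 1) := fun x =>
  (extDeriv (α.inChart x) (chartAt E x x)).compContinuousLinearMap
    (mfderiv 𝓘(ℝ, E) 𝓘(ℝ, E) (chartAt E x) x)

/-- The wedge product of forms. -/
noncomputable def wedge {p q n : ℕ} (h : p + q = n) (α : FormField E M p) (β : FormField E M q) :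
    FormField E M n := fun x => wedgeAlt h (α x) (β x)

theorem inChart_contDiffAt {k : ℕ} {α : FormField E M k} (hα : α.IsSmooth) (x₀ : M) {y : E}
    (hy : y ∈ (chartAt E x₀).target) : ContDiffAt ℝ ∞ (α.inChart x₀) y :=
  (hα x₀).contDiffAt ((chartAt E x₀).open_target.mem_nhds hy)

theorem IsSmooth.extDer_add {k : ℕ} {α β : FormField E M k} (hα : α.IsSmooth) (hβ : β.IsSmooth) :
    (α + β).extDer = α.extDer + β.extDer := by
  funext x
  have hy := (chartAt E x).map_source (mem_chart_source E x)
  have := _root_.extDeriv_add ((inChart_contDiffAt hα x hy).differentiableAt (by simp))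
    ((inChart_contDiffAt hβ x hy).differentiableAt (by simp))
  have h2 : (α + β).inChart x = α.inChart x + β.inChart x := rfl
  simp only [FormField.extDer, h2, this]
  rfl

theorem extDer_smul {k : ℕ} (c : ℝ) (α : FormField E M k) : (c • α).extDer = c • α.extDer := by
  funext x
  have h2 : (c • α).inChart x = c • α.inChart x := rfl
  simp only [FormField.extDer, h2, _root_.extDeriv_smul]
  rfl

theorem inChart_wedge {p q n : ℕ} (h : p + q = n) (α : FormField E M p) (β : FormField E M q)
    (x₀ : M) : (wedge h α β).inChart x₀ =
      fun y => wedgeAlt h (α.inChart x₀ y) (β.inChart x₀ y) := by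
  funext y
  exact (wedge_comp h _ _ _).symm

theorem IsSmooth.wedge {p q n : ℕ} (h : p + q = n) {α : FormField E M p} {β : FormField E M q}
    (hα : α.IsSmooth) (hβ : β.IsSmooth) : (wedge h α β).IsSmooth := by
  intro x₀
  rw [inChart_wedge]
  have h0 : ContDiff ℝ ∞ (wedgeCLM (E := E) h) := contDiff_wedgeCLM h
  exact (h0.comp_contDiffOn (hα x₀)).clm_apply (hβ x₀)

variable [IsManifold 𝓘(ℝ, E) ∞ M]

theorem mdiff_chart (x₀ : M) {x : M} (hx : x ∈ (chartAt E x₀).source) :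
    MDifferentiableAt 𝓘(ℝ, E) 𝓘(ℝ, E) (chartAt E x₀) x :=
  mdifferentiableAt_atlas (chart_mem_atlas E x₀) hx

theorem mdiff_chart_symm (x₀ : M) {y : E} (hy : y ∈ (chartAt E x₀).target) :
    MDifferentiableAt 𝓘(ℝ, E) 𝓘(ℝ, E) (chartAt E x₀).symm y :=
  mdifferentiableAt_atlas_symm (chart_mem_atlas E x₀) hy

theorem pullback_eq_inChart {k : ℕ} (α : FormField E M k) (x₀ : M) {f : F → M} {z : F}
    (hz : f z ∈ (chartAt E x₀).source) (hf : MDifferentiableAt 𝓘(ℝ, F) 𝓘(ℝ, E) f z) :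
    pullback (F := F) f α z = (α.inChart x₀ (chartAt E x₀ (f z))).compContinuousLinearMap
      (fderiv ℝ (chartAt E x₀ ∘ f) z) := by
  set e := chartAt E x₀
  have h1 : MDifferentiableAt 𝓘(ℝ, F) 𝓘(ℝ, E) (e ∘ f) z := (mdiff_chart x₀ hz).comp z hf
  have h2 := mdiff_chart_symm x₀ (e.map_source hz)
  have h3 : f =ᶠ[nhds z] e.symm ∘ (e ∘ f) := by
    filter_upwards [hf.continuousAt.preimage_mem_nhds (e.open_source.mem_nhds hz)] with w hw
    exact (e.left_inv hw).symm
  have h4 : mfderiv 𝓘(ℝ, F) 𝓘(ℝ, E) f z = (mfderiv 𝓘(ℝ, E) 𝓘(ℝ, E) e.symm (e (f z))).comp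
      (fderiv ℝ (e ∘ f) z) := by
    rw [h3.mfderiv_eq, mfderiv_comp z h2 h1, mfderiv_eq_fderiv]
    rfl
  have h5 : e.symm (e (f z)) = f z := e.left_inv hz
  have h6 : ∀ w : M, w = f z → ∀ L : F →L[ℝ] E,
      ((α w : E [⋀^Fin k]→L[ℝ] ℝ)).compContinuousLinearMap L =
      ((α (f z) : E [⋀^Fin k]→L[ℝ] ℝ)).compContinuousLinearMap L := by
    rintro w rfl L; rfl
  unfold pullback
  rw [h4]
  exact (h6 _ h5 _).symm

theorem extDeriv_pullback {k : ℕ} {α : FormField E M k} (hα : α.IsSmooth) {f : F → M} {z : F}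
    (hf : ContMDiffAt 𝓘(ℝ, F) 𝓘(ℝ, E) ∞ f z) :
    extDeriv (pullback (F := F) f α : F → F [⋀^Fin k]→L[ℝ] ℝ) z = pullback (F := F) f α.extDer z := by
  set e := chartAt E (f z) with he
  have hz : f z ∈ e.source := mem_chart_source E (f z)
  have hev : (pullback (F := F) f α : F → F [⋀^Fin k]→L[ℝ] ℝ) =ᶠ[nhds z] fun w =>
      (α.inChart (f z) ((e ∘ f) w)).compContinuousLinearMap (fderiv ℝ (e ∘ f) w) := by
    filter_upwards [hf.continuousAt.preimage_mem_nhds (e.open_source.mem_nhds hz),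
      (contMDiffAt_iff_contMDiffAt_nhds (by simp)).1 (hf.of_le (m := 1) (by simp))] with w hw hw'
    exact pullback_eq_inChart α (f z) hw (hw'.mdifferentiableAt (by simp))
  have hc : ContDiffAt ℝ ∞ (e ∘ f) z := by
    rw [← contMDiffAt_iff_contDiffAt]
    exact (contMDiffAt_of_mem_maximalAtlas (IsManifold.chart_mem_maximalAtlas _) hz).comp z hf
  have hd : DifferentiableAt ℝ (α.inChart (f z)) ((e ∘ f) z) :=
    (inChart_contDiffAt hα (f z) (e.map_source hz)).differentiableAt (by simp)
  rw [hev.extDeriv_eq, _root_.extDeriv_pullback hd hc two_le_infty]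
  have h1 : MDifferentiableAt 𝓘(ℝ, F) 𝓘(ℝ, E) f z := hf.mdifferentiableAt (by simp)
  have h4 : fderiv ℝ (e ∘ f) z = (mfderiv 𝓘(ℝ, E) 𝓘(ℝ, E) e (f z)).comp
      (mfderiv 𝓘(ℝ, F) 𝓘(ℝ, E) f z) := by
    rw [← mfderiv_eq_fderiv, mfderiv_comp z (mdiff_chart (f z) hz) h1]
  rw [h4]
  rfl

theorem inChart_extDer {k : ℕ} {α : FormField E M k} (hα : α.IsSmooth) (x₀ : M) {y : E}
    (hy : y ∈ (chartAt E x₀).target) :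
    α.extDer.inChart x₀ y = extDeriv (α.inChart x₀) y :=
  (FormField.extDeriv_pullback hα (contMDiffOn_symm_of_mem_maximalAtlas
    (IsManifold.chart_mem_maximalAtlas x₀) |>.contMDiffAt
      ((chartAt E x₀).open_target.mem_nhds hy))).symm

theorem IsSmooth.extDer {k : ℕ} {α : FormField E M k} (hα : α.IsSmooth) : α.extDer.IsSmooth := by
  intro x₀
  have : ContDiffOn ℝ ∞ (extDeriv (α.inChart x₀)) (chartAt E x₀).target := by
    intro y hy
    have := (inChart_contDiffAt hα x₀ hy).fderiv_right (m := ∞) (by simp)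
    exact ((ContinuousAlternatingMap.alternatizeUncurryFinCLM ℝ E ℝ).contDiff.contDiffAt.comp y
      this).contDiffWithinAt
  exact this.congr fun y hy => inChart_extDer hα x₀ hy

theorem eq_inChart_comp {k : ℕ} (γ : FormField E M k) (x : M) :
    γ x = (γ.inChart x (chartAt E x x)).compContinuousLinearMap
      (mfderiv 𝓘(ℝ, E) 𝓘(ℝ, E) (chartAt E x) x) := by
  have hx := mem_chart_source E x
  have h2 := mdiff_chart_symm x ((chartAt E x).map_source hx)
  have h3 : (chartAt E x).symm ∘ (chartAt E x) =ᶠ[nhds x] id := by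
    filter_upwards [(chartAt E x).open_source.mem_nhds hx] with w hw
    exact (chartAt E x).left_inv hw
  have h4 : (mfderiv 𝓘(ℝ, E) 𝓘(ℝ, E) (chartAt E x).symm (chartAt E x x)).comp
    (mfderiv 𝓘(ℝ, E) 𝓘(ℝ, E) (chartAt E x) x) = ContinuousLinearMap.id ℝ E := by
    rw [← mfderiv_comp x h2 (mdiff_chart x hx), h3.mfderiv_eq, mfderiv_id]
    rfl
  have h6 : ∀ w : M, w = x → ∀ L : E →L[ℝ] E, L = ContinuousLinearMap.id ℝ E →
    (γ x : E [⋀^Fin k]→L[ℝ] ℝ) = (γ w : E [⋀^Fin k]→L[ℝ] ℝ).compContinuousLinearMap L := by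
    rintro w rfl L rfl; rfl
  exact h6 _ ((chartAt E x).left_inv hx) _ h4

theorem eq_of_inChart {k : ℕ} {α β : FormField E M k} (x : M)
    (h : α.inChart x (chartAt E x x) = β.inChart x (chartAt E x x)) : α x = β x := by
  rw [eq_inChart_comp α, eq_inChart_comp β, h]

theorem inChart_pullback [IsManifold 𝓘(ℝ, F) ∞ N] {k : ℕ} (α : FormField E M k) {f : N → M}
    (hf : ContMDiff 𝓘(ℝ, F) 𝓘(ℝ, E) ∞ f) (x : N) {y : F} (hy : y ∈ (chartAt F x).target) :
    (pullback f α).inChart x y = pullback (F := F) (f ∘ (chartAt F x).symm) α y := by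
  have h := mfderiv_comp y (hf.mdifferentiableAt (by simp)) (mdiff_chart_symm x hy)
  unfold inChart pullback
  rw [h]
  rfl

theorem extDer_pullback [IsManifold 𝓘(ℝ, F) ∞ N] {k : ℕ} {α : FormField E M k}
    (hα : α.IsSmooth) {f : N → M} (hf : ContMDiff 𝓘(ℝ, F) 𝓘(ℝ, E) ∞ f) :
    extDer (E := F) (M := N) (pullback f α) = pullback f α.extDer := by
  funext x
  have hy := (chartAt F x).map_source (mem_chart_source F x)
  have h1 : (pullback f α).inChart x =ᶠ[nhds (chartAt F x x)]
      pullback (F := F) (f ∘ (chartAt F x).symm) α := by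
    filter_upwards [(chartAt F x).open_target.mem_nhds hy] with y hy'
    exact inChart_pullback α hf x hy'
  have h2 : ContMDiffAt 𝓘(ℝ, F) 𝓘(ℝ, E) ∞ (f ∘ (chartAt F x).symm) (chartAt F x x) :=
    hf.contMDiffAt.comp _ (contMDiffOn_symm_of_mem_maximalAtlas
      (IsManifold.chart_mem_maximalAtlas x) |>.contMDiffAt
        ((chartAt F x).open_target.mem_nhds hy))
  refine Eq.trans ?_ (eq_inChart_comp (E := F) (pullback (N := N) f α.extDer) x).symm
  rw [inChart_pullback α.extDer hf x hy, extDer, h1.extDeriv_eq,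
    FormField.extDeriv_pullback hα h2]

theorem extDer_extDer {k : ℕ} {α : FormField E M k} (hα : α.IsSmooth) : α.extDer.extDer = 0 := by
  funext x
  have hy := (chartAt E x).map_source (mem_chart_source E x)
  apply eq_of_inChart
  rw [inChart_extDer hα.extDer x hy]
  have : α.extDer.inChart x =ᶠ[nhds (chartAt E x x)] extDeriv (α.inChart x) := by
    filter_upwards [(chartAt E x).open_target.mem_nhds hy] with y hy'
    exact inChart_extDer hα x hy'
  rw [this.extDeriv_eq, extDeriv_extDeriv_apply (inChart_contDiffAt hα x hy) two_le_infty]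
  rfl

theorem extDer_wedge {p q n : ℕ} (h : p + q = n) (hl : p + 1 + q = n + 1)
    (hr : p + (q + 1) = n + 1) {α : FormField E M p} {β : FormField E M q}
    (hα : α.IsSmooth) (hβ : β.IsSmooth) :
    (wedge h α β).extDer = wedge hl α.extDer β + (-1 : ℝ) ^ p • wedge hr α β.extDer := by
  funext x
  have hy := (chartAt E x).map_source (mem_chart_source E x)
  apply eq_of_inChart
  rw [inChart_extDer (hα.wedge h hβ) x hy, inChart_wedge,
    extDeriv_wedge h hl hr ((inChart_contDiffAt hα x hy).differentiableAt (by simp))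
    ((inChart_contDiffAt hβ x hy).differentiableAt (by simp)),
    ← inChart_extDer hα x hy, ← inChart_extDer hβ x hy]
  have h2 : (wedge hl α.extDer β + (-1 : ℝ) ^ p • wedge hr α β.extDer).inChart x =
    (wedge hl α.extDer β).inChart x + (-1 : ℝ) ^ p • (wedge hr α β.extDer).inChart x := rfl
  rw [h2, inChart_wedge, inChart_wedge]
  rfl

end FormField
end Forms

section DGA
universe u
open CategoryTheory

/-- A differential graded algebra over `ℝ`, graded by `ℕ` with differential of degree `1`.
The product `A^p × A^q → A^n` is indexed by a proof of `p + q = n`. -/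
structure DGAlgebra : Type (u + 1) where
  X : ℕ → Type u
  [addCommGroup : ∀ k, AddCommGroup (X k)]
  [module : ∀ k, Module ℝ (X k)]
  d : ∀ k : ℕ, X k →ₗ[ℝ] X (k + 1)
  mul : ∀ {p q n : ℕ}, p + q = n → (X p →ₗ[ℝ] X q →ₗ[ℝ] X n)
  one : X 0
  d_d : ∀ {k : ℕ} (a : X k), d (k + 1) (d k a) = 0
  one_mul : ∀ {n : ℕ} (a : X n), mul (Nat.zero_add n) one a = a
  mul_one : ∀ {n : ℕ} (a : X n), mul (Nat.add_zero n) a one = a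
  mul_assoc : ∀ {p q r m k n : ℕ} (h₁ : p + q = m) (h₂ : m + r = n) (h₃ : q + r = k)
    (h₄ : p + k = n) (a : X p) (b : X q) (c : X r),
    mul h₂ (mul h₁ a b) c = mul h₄ a (mul h₃ b c)
  leibniz : ∀ {p q n : ℕ} (h : p + q = n) (h₁ : p + 1 + q = n + 1) (h₂ : p + (q + 1) = n + 1)
    (a : X p) (b : X q),
    d n (mul h a b) = mul h₁ (d p a) b + (-1 : ℝ) ^ p • mul h₂ a (d q b)

namespace DGAlgebra

attribute [instance] DGAlgebra.addCommGroup DGAlgebra.module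

/-- The `n`-th power of an element of degree `2`. -/
def powTwo (A : DGAlgebra.{u}) (a : A.X 2) : ∀ n : ℕ, A.X (2 * n)
  | 0 => A.one
  | n + 1 => A.mul (Nat.mul_succ 2 n).symm (powTwo A a n) a

/-- The underlying cochain complex. -/
def toCochainComplex (A : DGAlgebra.{u}) : CochainComplex (ModuleCat.{u} ℝ) ℕ :=
  CochainComplex.of (fun k => ModuleCat.of ℝ (A.X k)) (fun k => ModuleCat.ofHom (A.d k))
    (fun k => by ext a; exact A.d_d a)

/-- Morphisms of differential graded algebras. -/
structure Hom (A B : DGAlgebra.{u}) where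
  toLin : ∀ k : ℕ, A.X k →ₗ[ℝ] B.X k
  map_d : ∀ {k : ℕ} (a : A.X k), toLin (k + 1) (A.d k a) = B.d k (toLin k a)
  map_mul : ∀ {p q n : ℕ} (h : p + q = n) (a : A.X p) (b : A.X q),
    toLin n (A.mul h a b) = B.mul h (toLin p a) (toLin q b)
  map_one : toLin 0 A.one = B.one

/-- The underlying morphism of cochain complexes. -/
def Hom.toCochainMap {A B : DGAlgebra.{u}} (f : Hom A B) :
    A.toCochainComplex ⟶ B.toCochainComplex :=
  CochainComplex.ofHom (fun k => ModuleCat.ofHom (f.toLin k)) (fun k => by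
    simp only [toCochainComplex, CochainComplex.of_d]
    ext a
    exact (f.map_d a).symm)

/-- A morphism of differential graded algebras is a quasi-isomorphism if it induces an
isomorphism in cohomology. -/
def Hom.IsQuasiIso {A B : DGAlgebra.{u}} (f : Hom A B) : Prop := QuasiIso f.toCochainMap

/-- Differential graded subalgebras. -/
structure Sub (A : DGAlgebra.{u}) where
  carrier : ∀ k : ℕ, Submodule ℝ (A.X k)
  d_mem : ∀ {k : ℕ} {a : A.X k}, a ∈ carrier k → A.d k a ∈ carrier (k + 1)
  mul_mem : ∀ {p q n : ℕ} (h : p + q = n) {a : A.X p} {b : A.X q}, a ∈ carrier p →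
    b ∈ carrier q → A.mul h a b ∈ carrier n
  one_mem : A.one ∈ carrier 0

namespace Sub
variable {A : DGAlgebra.{u}}

/-- The intersection of two differential graded subalgebras. -/
instance : Min (Sub A) where
  min S S' :=
    { carrier := fun k => S.carrier k ⊓ S'.carrier k
      d_mem := fun h => ⟨S.d_mem h.1, S'.d_mem h.2⟩
      mul_mem := fun e _ _ h h' => ⟨S.mul_mem e h.1 h'.1, S'.mul_mem e h.2 h'.2⟩
      one_mem := ⟨S.one_mem, S'.one_mem⟩ }

/-- A differential graded subalgebra as a differential graded algebra. -/
def toDGAlgebra (S : Sub A) : DGAlgebra.{u} where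
  X k := S.carrier k
  d k := (A.d k).restrict fun _ h => S.d_mem h
  mul h := LinearMap.mk₂ ℝ (fun a b => ⟨A.mul h a.1 b.1, S.mul_mem h a.2 b.2⟩)
    (fun _ _ _ => Subtype.ext (by simp)) (fun _ _ _ => Subtype.ext (by simp))
    (fun _ _ _ => Subtype.ext (by simp)) (fun _ _ _ => Subtype.ext (by simp))
  one := ⟨A.one, S.one_mem⟩
  d_d a := Subtype.ext (A.d_d a.1)
  one_mul a := Subtype.ext (A.one_mul a.1)
  mul_one a := Subtype.ext (A.mul_one a.1)
  mul_assoc h₁ h₂ h₃ h₄ a b c := Subtype.ext (A.mul_assoc h₁ h₂ h₃ h₄ a.1 b.1 c.1)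
  leibniz h h₁ h₂ a b := Subtype.ext (A.leibniz h h₁ h₂ a.1 b.1)

/-- The inclusion of a differential graded subalgebra into a larger one. -/
def inclusion {S S' : Sub A} (hS : ∀ k, S.carrier k ≤ S'.carrier k) :
    Hom S.toDGAlgebra S'.toDGAlgebra where
  toLin k := Submodule.inclusion (hS k)
  map_d _ := rfl
  map_mul _ _ _ := rfl
  map_one := rfl

end Sub
end DGAlgebra
end DGA

section Cosymplectic
universe u v
variable {E : Type v} [NormedAddCommGroup E] [NormedSpace ℝ E]
  {M : Type u} [TopologicalSpace M] [ChartedSpace E M]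

namespace FormField

/-- The constant function `1` as a form of degree `0`. -/
noncomputable def one : FormField E M 0 := fun x =>
  ContinuousAlternatingMap.constOfIsEmpty ℝ (TangentSpace 𝓘(ℝ, E) x) (Fin 0) 1

theorem one_isSmooth : (one : FormField E M 0).IsSmooth := by
  intro x₀
  have : (one : FormField E M 0).inChart x₀ = fun _ =>
    ContinuousAlternatingMap.constOfIsEmpty ℝ E (Fin 0) 1 := by
    funext y; ext v; rfl
  rw [this]
  exact contDiffOn_const

variable (E M) in
/-- The space `Ω^k(M)` of smooth `k`-forms. -/
def smooth (k : ℕ) : Submodule ℝ (FormField E M k) where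
  carrier := {α | α.IsSmooth}
  add_mem' hα hβ := fun x₀ => (hα x₀).add (hβ x₀)
  zero_mem' := fun _ => contDiffOn_const (c := 0)
  smul_mem' c _ hα := fun x₀ => (hα x₀).const_smul c

theorem smooth.isSmooth {k : ℕ} (α : smooth E M k) : (α : FormField E M k).IsSmooth := α.2

theorem extDer_one : (one : FormField E M 0).extDer = 0 := by
  funext x
  have : (one : FormField E M 0).inChart x = fun _ =>
    ContinuousAlternatingMap.constOfIsEmpty ℝ E (Fin 0) 1 := by
    funext y; ext v; rfl
  rw [extDer, this, extDeriv, fderiv_fun_const]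
  have h0 : ContinuousAlternatingMap.alternatizeUncurryFin
      (0 : E →L[ℝ] E [⋀^Fin 0]→L[ℝ] ℝ) = 0 :=
    map_zero (ContinuousAlternatingMap.alternatizeUncurryFinCLM ℝ E ℝ)
  exact (congrArg (fun a : E [⋀^Fin 1]→L[ℝ] ℝ => a.compContinuousLinearMap
    (mfderiv 𝓘(ℝ, E) 𝓘(ℝ, E) (chartAt E x) x)) h0).trans rfl

variable (E M) in
/-- `d : Ω^k(M) → Ω^{k+1}(M)`. -/
noncomputable def dLin [IsManifold 𝓘(ℝ, E) ∞ M] (k : ℕ) :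
    smooth E M k →ₗ[ℝ] smooth E M (k + 1) where
  toFun α := ⟨α.1.extDer, (smooth.isSmooth α).extDer⟩
  map_add' α β := Subtype.ext ((smooth.isSmooth α).extDer_add (smooth.isSmooth β))
  map_smul' c α := Subtype.ext (extDer_smul c α.1)

variable (E M) in
/-- `∧ : Ω^p(M) × Ω^q(M) → Ω^n(M)`, `n = p + q`. -/
noncomputable def wedgeLin {p q n : ℕ} (h : p + q = n) :
    smooth E M p →ₗ[ℝ] smooth E M q →ₗ[ℝ] smooth E M n :=
  LinearMap.mk₂ ℝ
    (fun α β => ⟨FormField.wedge h α.1 β.1, (smooth.isSmooth α).wedge h (smooth.isSmooth β)⟩)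
    (fun _ _ _ => Subtype.ext (funext fun _ => wedge_add_left h _ _ _))
    (fun _ _ _ => Subtype.ext (funext fun _ => wedge_smul_left h _ _ _))
    (fun _ _ _ => Subtype.ext (funext fun _ => wedge_add_right h _ _ _))
    (fun _ _ _ => Subtype.ext (funext fun _ => wedge_smul_right h _ _ _))

/-- `ι_R α = 0` (no condition on functions). -/
def IsHorizontal (R : ∀ x : M, TangentSpace 𝓘(ℝ, E) x) : ∀ {k : ℕ}, FormField E M k → Prop
  | 0, _ => True
  | _ + 1, α => ∀ x v, α x (Fin.cons (R x) v) = 0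

theorem isHorizontal_iff (R : ∀ x : M, TangentSpace 𝓘(ℝ, E) x) {k : ℕ} (α : FormField E M k) :
    α.IsHorizontal R ↔ ∀ x v i, v i = R x → α x v = 0 := by
  cases k with
  | zero => exact ⟨fun _ _ _ i => i.elim0, fun _ => trivial⟩
  | succ k =>
    refine ⟨fun h x v i hi => ?_, fun h x v => h x _ 0 rfl⟩
    have h1 := (α x).toAlternatingMap.map_insertNth i (R x) (i.removeNth v)
    rw [← hi, Fin.insertNth_self_removeNth, hi] at h1
    refine h1.trans ?_
    have h2 := h x (i.removeNth v)
    exact (congrArg _ h2).trans (smul_zero _)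

theorem IsHorizontal.zero (R : ∀ x : M, TangentSpace 𝓘(ℝ, E) x) (k : ℕ) :
    (0 : FormField E M k).IsHorizontal R :=
  (isHorizontal_iff R 0).2 fun _ _ _ _ => rfl

theorem IsHorizontal.add {R : ∀ x : M, TangentSpace 𝓘(ℝ, E) x} {k : ℕ} {α β : FormField E M k}
    (hα : α.IsHorizontal R) (hβ : β.IsHorizontal R) : (α + β).IsHorizontal R := by
  rw [isHorizontal_iff] at *
  exact fun x v i hi => (congrArg₂ (· + ·) (hα x v i hi) (hβ x v i hi)).trans (add_zero 0)

theorem IsHorizontal.smul {R : ∀ x : M, TangentSpace 𝓘(ℝ, E) x} {k : ℕ} (c : ℝ)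
    {α : FormField E M k} (hα : α.IsHorizontal R) : (c • α).IsHorizontal R := by
  rw [isHorizontal_iff] at *
  exact fun x v i hi => (congrArg (c * ·) (hα x v i hi)).trans (mul_zero c)

theorem IsHorizontal.wedge {R : ∀ x : M, TangentSpace 𝓘(ℝ, E) x} {p q n : ℕ} (h : p + q = n)
    {α : FormField E M p} {β : FormField E M q} (hα : α.IsHorizontal R) (hβ : β.IsHorizontal R) :
    (wedge h α β).IsHorizontal R := by
  rw [isHorizontal_iff] at *
  exact fun x v i hi => wedge_eq_zero_of_mem h (α x) (β x) (R x) (hα x) (hβ x) v i hi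

/-- `α` is basic with respect to (the foliation by the integral curves of) `R`: `ι_R α = 0` and
`ι_R dα = 0`. Given `ι_R α = 0`, the second condition is `L_R α = 0`, as `L_R = ι_R d + d ι_R`. -/
def IsBasic (R : ∀ x : M, TangentSpace 𝓘(ℝ, E) x) {k : ℕ} (α : FormField E M k) : Prop :=
  α.IsHorizontal R ∧ α.extDer.IsHorizontal R

end FormField

variable (E M) in
/-- The de Rham algebra `Ω(M)`. -/
noncomputable def deRham [IsManifold 𝓘(ℝ, E) ∞ M] : DGAlgebra.{max u v} where
  X k := FormField.smooth E M k
  d k := FormField.dLin E M k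
  mul h := FormField.wedgeLin E M h
  one := ⟨FormField.one, FormField.one_isSmooth⟩
  d_d α := Subtype.ext (FormField.extDer_extDer (FormField.smooth.isSmooth α))
  one_mul α := Subtype.ext (funext fun x => by ext v; exact one_wedge _ rfl (α.1 x) v)
  mul_one α := Subtype.ext (funext fun x => by ext v; exact wedge_one _ rfl (α.1 x) v)
  mul_assoc h₁ h₂ h₃ h₄ α β γ :=
    Subtype.ext (funext fun x => wedge_assoc h₁ h₂ h₃ h₄ (α.1 x) (β.1 x) (γ.1 x))
  leibniz h h₁ h₂ α β := Subtype.ext (FormField.extDer_wedge h h₁ h₂ (FormField.smooth.isSmooth α)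
    (FormField.smooth.isSmooth β))

section Basic
variable [IsManifold 𝓘(ℝ, E) ∞ M]

/-- The differential graded algebra `Ω(M, F_R)` of `R`-basic forms. -/
noncomputable def basicForms (R : ∀ x : M, TangentSpace 𝓘(ℝ, E) x) : (deRham E M).Sub where
  carrier k :=
    { carrier := {α : FormField.smooth E M k | (α : FormField E M k).IsBasic R}
      add_mem' := by
        intro α β hα hβ
        refine ⟨hα.1.add hβ.1, ?_⟩
        have h := hα.2.add hβ.2
        rwa [← (FormField.smooth.isSmooth α).extDer_add (FormField.smooth.isSmooth β)] at h
      zero_mem' := by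
        refine ⟨.zero R k, ?_⟩
        have h : (0 : FormField E M k).extDer = 0 :=
          congrArg Subtype.val (map_zero (FormField.dLin E M k))
        exact h.symm ▸ FormField.IsHorizontal.zero R (k + 1)
      smul_mem' := by
        intro c α hα
        refine ⟨hα.1.smul c, ?_⟩
        have h := hα.2.smul c
        rwa [← FormField.extDer_smul] at h }
  d_mem {k α} h := by
    refine ⟨h.2, ?_⟩
    have := FormField.extDer_extDer (FormField.smooth.isSmooth α)
    exact this ▸ FormField.IsHorizontal.zero R (k + 2)
  mul_mem {p q n} h α β hα hβ := by
    refine ⟨hα.1.wedge h hβ.1, ?_⟩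
    have h1 := hα.2.wedge (n := n + 1) (by omega) hβ.1
    have h2 := hα.1.wedge (n := n + 1) (by omega) hβ.2
    have h3 := FormField.extDer_wedge h (by omega) (by omega) (FormField.smooth.isSmooth α)
      (FormField.smooth.isSmooth β)
    exact h3 ▸ h1.add (h2.smul _)
  one_mem := by
    refine ⟨trivial, ?_⟩
    exact FormField.extDer_one (E := E) (M := M) ▸ FormField.IsHorizontal.zero R 1

variable {F : Type*} [NormedAddCommGroup F] [NormedSpace ℝ F] {H : Type*} [TopologicalSpace H]
  (J : ModelWithCorners ℝ F H) (G : Type*) [TopologicalSpace G] [ChartedSpace H G] [Group G]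
  [MulAction G M]

theorem contMDiff_smul_left [ContMDiffSMul J 𝓘(ℝ, E) ∞ G M] (g : G) :
    ContMDiff 𝓘(ℝ, E) 𝓘(ℝ, E) ∞ (fun x : M => g • x) :=
  (ContMDiffSMul.contMDiff_smul (I := J) (I' := 𝓘(ℝ, E)) (n := ∞) (G := G) (M := M)).comp
    (contMDiff_const.prodMk contMDiff_id)

/-- The differential graded algebra `Ω(M)^G` of forms `α` with `g^*α = α` for all `g ∈ G`. -/
noncomputable def invariantForms [ContMDiffSMul J 𝓘(ℝ, E) ∞ G M] : (deRham E M).Sub where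
  carrier k :=
    { carrier := {α | ∀ g : G, FormField.pullback (fun x : M => g • x) α.1 = α.1}
      add_mem' := by
        intro α β h1 h2 g
        exact (congrArg₂ (fun a b => a + b) (h1 g) (h2 g))
      zero_mem' := fun _ => rfl
      smul_mem' := by
        intro c α h1 g
        exact (congrArg (fun a => c • a) (h1 g)) }
  d_mem {k α} h g := by
    exact (FormField.extDer_pullback (FormField.smooth.isSmooth α)
      (contMDiff_smul_left J G g)).symm.trans (congrArg FormField.extDer (h g))
  mul_mem {p q n} h α β hα hβ g := by
    refine Eq.trans ?_ (congrArg₂ (FormField.wedge h) (hα g) (hβ g))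
    funext x
    exact (wedge_comp h _ _ _).symm
  one_mem _ := rfl

/-- `(η, ω₂)` is a cosymplectic structure on the `(2n+1)`-dimensional manifold `M`: `dη = 0`,
`dω₂ = 0`, and `η ∧ ω₂^n` vanishes nowhere. -/
structure IsCosymplectic (n : ℕ) (η : FormField.smooth E M 1) (ω₂ : FormField.smooth E M 2) :
    Prop where
  d_eta : FormField.dLin E M 1 η = 0
  d_omega : FormField.dLin E M 2 ω₂ = 0
  volume_ne_zero : ∀ x : M, (FormField.wedgeLin E M (Nat.add_comm 1 (2 * n)) η
    ((deRham E M).powTwo ω₂ n)).1 x ≠ 0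

end Basic

/-- `R` is the Reeb field of `(η, ω₂)`: `ι_R η = 1` and `ι_R ω₂ = 0`. -/
def IsReebField (η : FormField.smooth E M 1) (ω₂ : FormField.smooth E M 2)
    (R : ∀ x : M, TangentSpace 𝓘(ℝ, E) x) : Prop :=
  ∀ x : M, η.1 x ![R x] = 1 ∧ ∀ v : TangentSpace 𝓘(ℝ, E) x, ω₂.1 x ![R x, v] = 0

/-- `G` acts by cosymplectomorphisms: `g^*η = η` and `g^*ω₂ = ω₂` for all `g ∈ G`. -/
def IsCosymplecticAction (G : Type*) [SMul G M] (η : FormField.smooth E M 1)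
    (ω₂ : FormField.smooth E M 2) : Prop :=
  ∀ g : G, FormField.pullback (fun x : M => g • x) η.1 = η.1 ∧
    FormField.pullback (fun x : M => g • x) ω₂.1 = ω₂.1

end Cosymplectic

/-!
Basic forms are averaged over the torus, one circle factor at a time.

Let `Φ_t`, of period `1`, be the flow of a circle factor. For a form `α` put `Aα = ∫₀¹ Φ_t^*α dt`
(`FormField.average`). Differentiation under the integral sign shows that `Aα` is smooth and that
`A` commutes with `d`. The form `Aα` is invariant under `Φ` (`FormField.pullback_average_self`),
and, since the torus is commutative, `A` keeps the invariance under the other circles. If `α` is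
closed of positive degree, then `∂_t Φ_t^*α = d ι_t`, where `ι_t` is the contraction of `Φ_t^*α`
with the velocity of `Φ`: this is the equation `da = 0` for the pull-back `a` of `α` to a cylinder
`ℝ × E` over a chart (`hasDerivAt_slice_of_closed`). Integration by parts gives
`Aα = α + d ∫₀¹ (1 - t) ι_t dt` (`FormField.average_eq_add_dLin_homotopy`).

The maps `g` of the torus satisfy `g_* R = R`: the vector `g_* R - R` is annihilated by `η` and
`ω`, hence by the nowhere vanishing form `η ∧ ω^n` of top degree, so it is zero
(`IsReebField.mfderiv_apply`). Hence `A` preserves basic forms. The primitive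
`β = ∫₀¹ (1 - t) ι_t dt` of `Aα - α` is basic as well: it is horizontal because contractions
anticommute, and `dβ = Aα - α` is a difference of horizontal forms
(`FormField.isBasic_homotopy`).

After all circles have been used, every closed basic form is cohomologous to an invariant one,
through a basic primitive (`exists_invariant_cohomologous`), and an invariant form with a basic
primitive has an invariant basic one (`exists_invariant_primitive`). In degree `0` closed forms
are locally constant, hence invariant. This is bijectivity in cohomology
(`DGAlgebra.Hom.isQuasiIso_of_elements`).
-/

/-! ### Integrals with parameters and pull-backs of alternating forms -/

section ParametricIntegral
open MeasureTheory Set Filter Topology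
variable {E G : Type*} [NormedAddCommGroup E] [NormedSpace ℝ E]
  [NormedAddCommGroup G] [NormedSpace ℝ G] {U : Set E} {f : ℝ × E → G}

omit [NormedSpace ℝ E] [NormedSpace ℝ G] in
theorem ContinuousOn.continuous_slice (hf : ContinuousOn f (univ ×ˢ U)) {y : E} (hy : y ∈ U) :
    Continuous fun t : ℝ => f (t, y) :=
  hf.comp_continuous (by fun_prop) fun _ => ⟨mem_univ _, hy⟩

theorem hasFDerivAt_intervalIntegral_of_contDiffOn (hU : IsOpen U)
    (hf : ContDiffOn ℝ 1 f (univ ×ˢ U)) (a b : ℝ) {y : E} (hy : y ∈ U) :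
    HasFDerivAt (fun z => ∫ t in a..b, f (t, z))
      (∫ t in a..b, (fderiv ℝ f (t, y)).comp (ContinuousLinearMap.inr ℝ ℝ E)) y := by
  have hO : IsOpen ((univ : Set ℝ) ×ˢ U) := isOpen_univ.prod hU
  have hd : ContinuousOn (fun p => (fderiv ℝ f p).comp (ContinuousLinearMap.inr ℝ ℝ E))
      (univ ×ˢ U) :=
    (hf.continuousOn_fderiv_of_isOpen hO le_rfl).clm_comp continuousOn_const
  obtain ⟨C, hC⟩ := (isCompact_uIcc (a := a) (b := b)).exists_bound_of_continuousOn
    (hd.continuous_slice hy).continuousOn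
  -- the derivative is bounded by `C` on `[a, b] × {y}`, hence by `C + 1` on a tube around it
  have hW : IsOpen ((univ ×ˢ U) ∩
      (fun p => ‖(fderiv ℝ f p).comp (ContinuousLinearMap.inr ℝ ℝ E)‖) ⁻¹' Iio (C + 1)) :=
    hd.norm.isOpen_inter_preimage hO isOpen_Iio
  obtain ⟨V, S, -, hS, hV, hyS, hVS⟩ := generalized_tube_lemma (isCompact_uIcc (a := a) (b := b))
    (isCompact_singleton (x := y)) hW (by
      rintro ⟨t, z⟩ ⟨ht, rfl : z = y⟩
      exact ⟨⟨mem_univ _, hy⟩, (hC t ht).trans_lt (lt_add_one C)⟩)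
  refine intervalIntegral.hasFDerivAt_integral_of_dominated_of_fderiv_le
    (F := fun z t => f (t, z)) (bound := fun _ => C + 1) (s := S)
    (F' := fun z t => (fderiv ℝ f (t, z)).comp (ContinuousLinearMap.inr ℝ ℝ E))
    (hS.mem_nhds (hyS rfl)) ?_ ((hf.continuousOn.continuous_slice hy).intervalIntegrable _ _)
    (hd.continuous_slice hy).aestronglyMeasurable ?_ intervalIntegrable_const ?_
  · filter_upwards [hU.mem_nhds hy] with z hz
    exact (hf.continuousOn.continuous_slice hz).aestronglyMeasurable
  · exact Eventually.of_forall fun t ht z hz =>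
      (hVS ⟨hV (uIoc_subset_uIcc ht), hz⟩).2.le
  · refine Eventually.of_forall fun t ht z hz => ?_
    have hz' := (hVS (⟨hV (uIoc_subset_uIcc ht), hz⟩ : (t, z) ∈ V ×ˢ S)).1
    have h1 := ((hf.contDiffAt (hO.mem_nhds hz')).differentiableAt one_ne_zero).hasFDerivAt
    exact h1.comp z (hasFDerivAt_prodMk_right t z)

end ParametricIntegral

section ParametricIntegralSmooth
open MeasureTheory Set
universe u
variable {E : Type u} [NormedAddCommGroup E] [NormedSpace ℝ E] {U : Set E}

theorem ContDiffOn.intervalIntegral {G : Type u} [NormedAddCommGroup G] [NormedSpace ℝ G]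
    {f : ℝ × E → G} (hU : IsOpen U) (hf : ContDiffOn ℝ ∞ f (univ ×ˢ U)) (a b : ℝ) :
    ContDiffOn ℝ ∞ (fun z => ∫ t in a..b, f (t, z)) U := by
  have hO : IsOpen ((univ : Set ℝ) ×ˢ U) := isOpen_univ.prod hU
  rw [contDiffOn_infty]
  intro n
  induction n generalizing G with
  | zero =>
    exact contDiffOn_zero.2 fun y hy => (hasFDerivAt_intervalIntegral_of_contDiffOn hU
      (hf.of_le (by simp)) a b hy).continuousAt.continuousWithinAt
  | succ n ih =>
    have h1 := fun y (hy : y ∈ U) => hasFDerivAt_intervalIntegral_of_contDiffOn hU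
      (hf.of_le (by simp)) a b hy
    rw [Nat.cast_succ]
    refine (contDiffOn_succ_iff_fderiv_of_isOpen hU).2 ⟨fun y hy =>
      (h1 y hy).differentiableAt.differentiableWithinAt, by simp, ?_⟩
    refine (ih (f := fun p => (fderiv ℝ f p).comp (ContinuousLinearMap.inr ℝ ℝ E))
      ((hf.fderiv_of_isOpen hO (by simp)).clm_comp contDiffOn_const)).congr
      fun y hy => (h1 y hy).fderiv

end ParametricIntegralSmooth

section AlternatingCalculus
variable {E F : Type*} [NormedAddCommGroup E] [NormedSpace ℝ E] [NormedAddCommGroup F]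
  [NormedSpace ℝ F] {k : ℕ}

/-- Antisymmetrization `f ↦ ∑_σ sign(σ) f ∘ σ` as a continuous linear map. -/
noncomputable def alternatizationCLM (E : Type*) [NormedAddCommGroup E] [NormedSpace ℝ E] (k : ℕ) :
    ContinuousMultilinearMap ℝ (fun _ : Fin k => E) ℝ →L[ℝ] E [⋀^Fin k]→L[ℝ] ℝ :=
  AlternatingMap.mkContinuousLinear
    { toFun := fun f => MultilinearMap.alternatization f.toMultilinearMap
      map_add' := fun f g => map_add MultilinearMap.alternatization f.toMultilinearMap
        g.toMultilinearMap
      map_smul' := fun c f => by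
        ext v
        simp [MultilinearMap.alternatization_apply, Finset.mul_sum, mul_smul_comm] }
    (k ! : ℝ) (by
      intro f v
      simp only [LinearMap.coe_mk, AddHom.coe_mk, MultilinearMap.alternatization_apply]
      have key : ∀ σ : Equiv.Perm (Fin k), ‖Equiv.Perm.sign σ •
          (f.toMultilinearMap.domDomCongr σ) v‖ ≤ ‖f‖ * ∏ i, ‖v i‖ := by
        intro σ
        rw [Units.smul_def, zsmul_eq_mul, norm_mul]
        have hs : ‖((Equiv.Perm.sign σ : ℤ) : ℝ)‖ = 1 := by
          rcases Int.units_eq_one_or (Equiv.Perm.sign σ) with h | h <;> simp [h]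
        rw [hs, one_mul, ← Equiv.prod_comp σ]
        exact f.le_opNorm _
      refine (norm_sum_le _ _).trans ((Finset.sum_le_sum fun σ _ => key σ).trans ?_)
      simp [Fintype.card_perm, mul_assoc])

theorem alternatizationCLM_toContinuousMultilinearMap (a : E [⋀^Fin k]→L[ℝ] ℝ) :
    alternatizationCLM E k a.toContinuousMultilinearMap = (k ! : ℝ) • a := by
  ext v
  refine Eq.trans ?_ (altSum_alternating a v)
  simp only [altSum]
  refine (MultilinearMap.alternatization_apply _ _).trans (Finset.sum_congr rfl fun σ _ => ?_)
  rw [Units.smul_def, zsmul_eq_mul]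
  rfl

/-- The pull-back of an alternating form along a linear map depends smoothly on both. The map is
polynomial into the multilinear maps, and antisymmetrization retracts these onto the alternating
ones. -/
theorem contDiff_compContinuousLinearMap : ContDiff ℝ ∞
    fun p : (E [⋀^Fin k]→L[ℝ] ℝ) × (F →L[ℝ] E) => p.1.compContinuousLinearMap p.2 := by
  have h1 : ContDiff ℝ ∞ fun p : (E [⋀^Fin k]→L[ℝ] ℝ) × (F →L[ℝ] E) =>
      ContinuousMultilinearMap.compContinuousLinearMapContinuousMultilinear ℝ
        (fun _ : Fin k => F) (fun _ => E) ℝ (fun _ => p.2) :=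
    (ContinuousMultilinearMap.contDiff _).comp (contDiff_pi.2 fun _ => contDiff_snd)
  have h2 : ContDiff ℝ ∞ fun p : (E [⋀^Fin k]→L[ℝ] ℝ) × (F →L[ℝ] E) =>
      p.1.toContinuousMultilinearMap :=
    (ContinuousAlternatingMap.toContinuousMultilinearMapCLM (𝕜 := ℝ) (E := E) (F := ℝ)
      (ι := Fin k) ℝ).contDiff.comp contDiff_fst
  have h3 := ((alternatizationCLM F k).contDiff.comp (h1.clm_apply h2)).const_smul
    ((k ! : ℝ)⁻¹)
  convert! h3 using 1
  funext p
  have h4 := alternatizationCLM_toContinuousMultilinearMap (p.1.compContinuousLinearMap p.2)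
  refine Eq.trans ?_ (congrArg (fun b => (k ! : ℝ)⁻¹ • b) h4).symm
  rw [smul_smul, inv_mul_cancel₀ (by positivity), one_smul]

end AlternatingCalculus

section Contraction
variable {V : Type*} [AddCommGroup V] [Module ℝ V] [TopologicalSpace V] {k : ℕ}

/-- The contraction `ι_u a = a(u, ·, …, ·)` of an alternating form with a vector. -/
def contract (u : V) (a : V [⋀^Fin (k + 1)]→L[ℝ] ℝ) : V [⋀^Fin k]→L[ℝ] ℝ where
  toMultilinearMap := (a.toAlternatingMap.curryLeft u).toMultilinearMap
  map_eq_zero_of_eq' := (a.toAlternatingMap.curryLeft u).map_eq_zero_of_eq'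
  cont := a.cont.comp (continuous_const.matrixVecCons continuous_id)

end Contraction

section ContractionCalculus
variable {E : Type*} [NormedAddCommGroup E] [NormedSpace ℝ E] {k : ℕ}

/-- The contraction with a fixed vector as a continuous linear map. -/
noncomputable def contractCLM (k : ℕ) (u : E) :
    (E [⋀^Fin (k + 1)]→L[ℝ] ℝ) →L[ℝ] E [⋀^Fin k]→L[ℝ] ℝ :=
  LinearMap.mkContinuous
    { toFun := contract u
      map_add' := fun _ _ => rfl
      map_smul' := fun _ _ => rfl } ‖u‖ (by
    intro a
    refine ContinuousAlternatingMap.opNorm_le_bound _ (by positivity) fun v => ?_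
    refine (a.le_opNorm (Fin.cons u v)).trans_eq ?_
    rw [Fin.prod_univ_succ]
    simp only [Fin.cons_zero, Fin.cons_succ]
    ring)

@[simp] theorem contractCLM_apply (u : E) (a : E [⋀^Fin (k + 1)]→L[ℝ] ℝ) :
    contractCLM k u a = contract u a := rfl

end ContractionCalculus

/-! ### Smooth families of forms and their integrals -/

namespace FormField
section Families
open Set MeasureTheory
universe u
variable {E : Type u} [NormedAddCommGroup E] [NormedSpace ℝ E]
  {M : Type*} [TopologicalSpace M] [ChartedSpace E M] {k : ℕ}

/-- A one-parameter family of `k`-forms is smooth if its representatives in charts depend smoothly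
on the parameter and the point jointly. -/
def IsSmoothFamily (α : ℝ → FormField E M k) : Prop :=
  ∀ x₀ : M, ContDiffOn ℝ ∞ (fun p : ℝ × E => (α p.1).inChart x₀ p.2)
    (univ ×ˢ (chartAt E x₀).target)

/-- The form `∫₀¹ α_t dt`, computed in each tangent space. -/
noncomputable def integral (α : ℝ → FormField E M k) : FormField E M k := fun x =>
  intervalIntegral (E := E [⋀^Fin k]→L[ℝ] ℝ) (fun t => α t x) 0 1 volume

theorem integral_congr {α β : ℝ → FormField E M k} (h : ∀ t, α t = β t) :
    integral α = integral β :=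
  congrArg integral (funext h)

theorem IsSmoothFamily.isSmooth {α : ℝ → FormField E M k} (hα : IsSmoothFamily α) (t : ℝ) :
    (α t).IsSmooth := fun x₀ =>
  (hα x₀).comp (contDiff_const.prodMk contDiff_id).contDiffOn fun _ hy => ⟨mem_univ t, hy⟩

theorem IsSmoothFamily.smul {α : ℝ → FormField E M k} (hα : IsSmoothFamily α) {w : ℝ → ℝ}
    (hw : ContDiff ℝ ∞ w) : IsSmoothFamily fun t => w t • α t := fun x₀ =>
  (hw.comp contDiff_fst).contDiffOn.smul (hα x₀)

variable [IsManifold 𝓘(ℝ, E) ∞ M]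

theorem IsSmoothFamily.continuous_apply {α : ℝ → FormField E M k} (hα : IsSmoothFamily α) (x : M) :
    Continuous fun t => (α t x : E [⋀^Fin k]→L[ℝ] ℝ) := by
  have h := (hα x).continuousOn.continuous_slice
    ((chartAt E x).map_source (mem_chart_source E x))
  have h2 : (fun t => (α t x : E [⋀^Fin k]→L[ℝ] ℝ)) = fun t =>
      ContinuousAlternatingMap.compContinuousLinearMapCLM
        (mfderiv 𝓘(ℝ, E) 𝓘(ℝ, E) (chartAt E x) x : E →L[ℝ] E)
        ((α t).inChart x (chartAt E x x)) := funext fun t => eq_inChart_comp (α t) x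
  rw [h2]
  exact (ContinuousLinearMap.continuous _).comp h

theorem pullback_integral_apply {F N : Type*} [NormedAddCommGroup F] [NormedSpace ℝ F]
    [TopologicalSpace N] [ChartedSpace F N] {α : ℝ → FormField E M k} (hα : IsSmoothFamily α)
    (f : N → M) (y : N) : pullback (F := F) f (integral α) y =
      intervalIntegral (E := F [⋀^Fin k]→L[ℝ] ℝ) (fun t => pullback (F := F) f (α t) y)
        0 1 volume :=
  (ContinuousLinearMap.intervalIntegral_comp_comm (𝕜 := ℝ) (E := E [⋀^Fin k]→L[ℝ] ℝ)
    (F := F [⋀^Fin k]→L[ℝ] ℝ) (ContinuousAlternatingMap.compContinuousLinearMapCLM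
      (mfderiv 𝓘(ℝ, F) 𝓘(ℝ, E) f y : F →L[ℝ] E))
    ((hα.continuous_apply (f y)).intervalIntegrable 0 1)).symm

theorem pullback_integral {α : ℝ → FormField E M k} (hα : IsSmoothFamily α) (f : M → M) :
    pullback f (integral α) = integral (E := E) (M := M) fun t => pullback f (α t) :=
  funext fun y => pullback_integral_apply hα f y

theorem inChart_integral {α : ℝ → FormField E M k} (hα : IsSmoothFamily α) (x₀ : M) :
    (integral α).inChart x₀ = fun y => ∫ t in (0 : ℝ)..1, (α t).inChart x₀ y :=
  funext fun y => pullback_integral_apply hα _ y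

theorem isSmooth_integral {α : ℝ → FormField E M k} (hα : IsSmoothFamily α) :
    (integral α).IsSmooth := by
  intro x₀
  rw [inChart_integral hα]
  exact (hα x₀).intervalIntegral (chartAt E x₀).open_target 0 1

omit [IsManifold 𝓘(ℝ, E) ∞ M] in
theorem IsSmoothFamily.hasFDerivAt_slice {α : ℝ → FormField E M k} (hα : IsSmoothFamily α)
    (x₀ : M) (t : ℝ) {y : E} (hy : y ∈ (chartAt E x₀).target) :
    HasFDerivAt ((α t).inChart x₀) ((fderiv ℝ (fun p : ℝ × E => (α p.1).inChart x₀ p.2)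
      (t, y)).comp (ContinuousLinearMap.inr ℝ ℝ E)) y := by
  have hty : (t, y) ∈ (univ : Set ℝ) ×ˢ (chartAt E x₀).target := ⟨mem_univ t, hy⟩
  have h1 := (((hα x₀).contDiffAt ((isOpen_univ.prod (chartAt E x₀).open_target).mem_nhds
    hty)).differentiableAt (by simp)).hasFDerivAt
  exact h1.comp y (hasFDerivAt_prodMk_right t y)

theorem IsSmoothFamily.inChart_extDer {α : ℝ → FormField E M k} (hα : IsSmoothFamily α)
    (x₀ : M) (t : ℝ) {y : E} (hy : y ∈ (chartAt E x₀).target) :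
    (α t).extDer.inChart x₀ y = ContinuousAlternatingMap.alternatizeUncurryFinCLM ℝ E ℝ
      ((fderiv ℝ (fun p : ℝ × E => (α p.1).inChart x₀ p.2)
        (t, y)).comp (ContinuousLinearMap.inr ℝ ℝ E)) := by
  rw [FormField.inChart_extDer (hα.isSmooth t) x₀ hy, extDeriv,
    (hα.hasFDerivAt_slice x₀ t hy).fderiv]
  rfl

theorem IsSmoothFamily.extDer {α : ℝ → FormField E M k} (hα : IsSmoothFamily α) :
    IsSmoothFamily fun t => (α t).extDer := by
  intro x₀
  have h1 : ContDiffOn ℝ ∞ (fun p : ℝ × E =>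
      (fderiv ℝ (fun p : ℝ × E => (α p.1).inChart x₀ p.2) p).comp
        (ContinuousLinearMap.inr ℝ ℝ E)) (univ ×ˢ (chartAt E x₀).target) :=
    ((hα x₀).fderiv_of_isOpen (isOpen_univ.prod (chartAt E x₀).open_target)
      (by simp)).clm_comp contDiffOn_const
  have h2 : ContDiff ℝ ∞ (ContinuousAlternatingMap.alternatizeUncurryFinCLM (n := k) ℝ E ℝ) :=
    ContinuousLinearMap.contDiff (𝕜 := ℝ) (E := E →L[ℝ] E [⋀^Fin k]→L[ℝ] ℝ)
      (F := E [⋀^Fin (k + 1)]→L[ℝ] ℝ) _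
  exact (h2.comp_contDiffOn h1).congr fun p hp => hα.inChart_extDer x₀ p.1 hp.2

theorem extDer_integral {α : ℝ → FormField E M k} (hα : IsSmoothFamily α) :
    (integral α).extDer = integral fun t => (α t).extDer := by
  funext x
  apply eq_of_inChart
  have hy := (chartAt E x).map_source (mem_chart_source E x)
  rw [FormField.inChart_extDer (isSmooth_integral hα) x hy, inChart_integral hα.extDer,
    inChart_integral hα, extDeriv, (hasFDerivAt_intervalIntegral_of_contDiffOn
      (chartAt E x).open_target ((hα x).of_le (by simp)) 0 1 hy).fderiv]
  simp only [hα.inChart_extDer x _ hy]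
  refine (ContinuousLinearMap.intervalIntegral_comp_comm (𝕜 := ℝ)
    (E := E →L[ℝ] E [⋀^Fin k]→L[ℝ] ℝ) (F := E [⋀^Fin (k + 1)]→L[ℝ] ℝ)
    (ContinuousAlternatingMap.alternatizeUncurryFinCLM ℝ E ℝ) ?_).symm
  have h1 : ContinuousOn (fun p : ℝ × E =>
      (fderiv ℝ (fun p : ℝ × E => (α p.1).inChart x p.2) p).comp
        (ContinuousLinearMap.inr ℝ ℝ E)) (univ ×ˢ (chartAt E x).target) :=
    ((hα x).continuousOn_fderiv_of_isOpen (isOpen_univ.prod (chartAt E x).open_target)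
      (by simp)).clm_comp continuousOn_const
  have h2 := ContinuousOn.continuous_slice (G := E →L[ℝ] E [⋀^Fin k]→L[ℝ] ℝ) h1 hy
  exact Continuous.intervalIntegrable (E := E →L[ℝ] E [⋀^Fin k]→L[ℝ] ℝ) h2 0 1

theorem IsHorizontal.integral {α : ℝ → FormField E M k} (hα : IsSmoothFamily α)
    {R : ∀ x : M, TangentSpace 𝓘(ℝ, E) x} (h : ∀ t, (α t).IsHorizontal R) :
    (integral α).IsHorizontal R := by
  rw [isHorizontal_iff]
  intro x v i hi
  refine ((ContinuousAlternatingMap.apply ℝ E ℝ v).intervalIntegral_comp_comm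
    ((hα.continuous_apply x).intervalIntegrable 0 1)).symm.trans ?_
  refine (intervalIntegral.integral_congr (g := fun _ => (0 : ℝ)) fun t _ => ?_).trans (by simp)
  exact (isHorizontal_iff R (α t)).1 (h t) x v i hi

end Families
end FormField

/-! ### The homotopy formula for a one-parameter family of maps -/

section Homotopy

/-- Integration by parts with the weight `1 - t`. -/
theorem intervalIntegral_eq_add_integral_one_sub_smul {G : Type*} [NormedAddCommGroup G]
    [NormedSpace ℝ G] [CompleteSpace G] {c c' : ℝ → G} (h : ∀ t, HasDerivAt c (c' t) t)
    (hc' : Continuous c') :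
    ∫ t in (0 : ℝ)..1, c t = c 0 + ∫ t in (0 : ℝ)..1, (1 - t) • c' t := by
  have hc : Continuous c := continuous_iff_continuousAt.2 fun t => (h t).continuousAt
  have h1 : ∀ t : ℝ, HasDerivAt (fun s => (1 - s) • c s) ((1 - t) • c' t - c t) t := by
    intro t
    have h2 := ((hasDerivAt_id t).const_sub 1).smul (h t)
    simp only [id, neg_smul, one_smul, ← sub_eq_add_neg] at h2
    exact h2
  have hc1 : Continuous fun t => (1 - t) • c' t := (continuous_const.sub continuous_id).smul hc'
  have h3 := intervalIntegral.integral_eq_sub_of_hasDerivAt (fun t _ => h1 t)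
    ((hc1.sub hc).intervalIntegrable 0 1)
  rw [intervalIntegral.integral_sub (hc1.intervalIntegrable 0 1) (hc.intervalIntegrable 0 1)]
    at h3
  simp only [sub_self, zero_smul, sub_zero, one_smul, zero_sub] at h3
  rw [sub_eq_iff_eq_add.1 h3]
  abel

end Homotopy

namespace FormField
section Flow
open Set MeasureTheory ContinuousAlternatingMap
universe u
variable {E : Type u} [NormedAddCommGroup E] [NormedSpace ℝ E]
  {M : Type*} [TopologicalSpace M] [ChartedSpace E M] {k : ℕ}

/-- The contraction of `(Φ_t)^*α` with the velocity `∂_t Φ_t`: at `x` it is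
`v ↦ α(∂_t Φ_t(x), dΦ_t v₁, …, dΦ_t v_k)`. -/
noncomputable def flowContract (Φ : ℝ → M → M) (α : FormField E M (k + 1)) (t : ℝ) :
    FormField E M k := fun x =>
  (contract (V := TangentSpace 𝓘(ℝ, E) (Φ t x))
    (mfderiv 𝓘(ℝ, ℝ) 𝓘(ℝ, E) (fun s => Φ s x) t (1 : ℝ)) (α (Φ t x))).compContinuousLinearMap
      (mfderiv 𝓘(ℝ, E) 𝓘(ℝ, E) (Φ t) x)

variable [IsManifold 𝓘(ℝ, E) ∞ M]

theorem contDiffAt_pullback {F : Type*} [NormedAddCommGroup F] [NormedSpace ℝ F]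
    {α : FormField E M k} (hα : α.IsSmooth) {f : F → M} {z : F}
    (hf : ContMDiffAt 𝓘(ℝ, F) 𝓘(ℝ, E) ∞ f z) :
    ContDiffAt (F := F [⋀^Fin k]→L[ℝ] ℝ) ℝ ∞ (pullback (F := F) f α) z := by
  set e := chartAt E (f z) with he
  have hz : f z ∈ e.source := mem_chart_source E (f z)
  have hev : (pullback (F := F) f α : F → F [⋀^Fin k]→L[ℝ] ℝ) =ᶠ[nhds z] fun w =>
      (α.inChart (f z) ((e ∘ f) w)).compContinuousLinearMap (fderiv ℝ (e ∘ f) w) := by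
    filter_upwards [hf.continuousAt.preimage_mem_nhds (e.open_source.mem_nhds hz),
      (contMDiffAt_iff_contMDiffAt_nhds (by simp)).1 (hf.of_le (m := 1) (by simp))] with w hw hw'
    exact pullback_eq_inChart α (f z) hw (hw'.mdifferentiableAt (by simp))
  have hc : ContDiffAt ℝ ∞ (e ∘ f) z := by
    rw [← contMDiffAt_iff_contDiffAt]
    exact (contMDiffAt_of_mem_maximalAtlas (IsManifold.chart_mem_maximalAtlas _) hz).comp z hf
  have h1 : ContDiffAt ℝ ∞ (fun w => α.inChart (f z) ((e ∘ f) w)) z :=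
    (inChart_contDiffAt hα (f z) (e.map_source hz)).comp z hc
  have h2 := contDiff_compContinuousLinearMap.contDiffAt.comp z
    (h1.prodMk (hc.fderiv_right (m := ∞) (by simp)))
  exact h2.congr_of_eventuallyEq hev

section
variable {Φ : ℝ → M → M}
  (hΦ : ContMDiff (𝓘(ℝ, ℝ).prod 𝓘(ℝ, E)) 𝓘(ℝ, E) ∞ fun p : ℝ × M => Φ p.1 p.2)
include hΦ

omit [IsManifold 𝓘(ℝ, E) ∞ M] in
theorem contMDiff_flow (t : ℝ) : ContMDiff 𝓘(ℝ, E) 𝓘(ℝ, E) ∞ (Φ t) :=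
  hΦ.comp (contMDiff_const.prodMk contMDiff_id)

theorem contMDiffAt_flow_chart (x₀ : M) (t : ℝ) {y : E} (hy : y ∈ (chartAt E x₀).target) :
    ContMDiffAt 𝓘(ℝ, ℝ × E) 𝓘(ℝ, E) ∞
      (fun p : ℝ × E => Φ p.1 ((chartAt E x₀).symm p.2)) (t, y) := by
  have h1 : ContMDiffAt 𝓘(ℝ, E) 𝓘(ℝ, E) ∞ (chartAt E x₀).symm y :=
    (contMDiffOn_symm_of_mem_maximalAtlas (IsManifold.chart_mem_maximalAtlas x₀)).contMDiffAt
      ((chartAt E x₀).open_target.mem_nhds hy)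
  have h2 : ContMDiffAt 𝓘(ℝ, ℝ × E) 𝓘(ℝ, ℝ) ∞ (Prod.fst : ℝ × E → ℝ) (t, y) :=
    contDiff_fst.contMDiff.contMDiffAt
  have h3 : ContMDiffAt 𝓘(ℝ, ℝ × E) 𝓘(ℝ, E) ∞ (Prod.snd : ℝ × E → E) (t, y) :=
    contDiff_snd.contMDiff.contMDiffAt
  exact (hΦ.contMDiffAt (x := (t, (chartAt E x₀).symm y))).comp (t, y)
    (h2.prodMk (ContMDiffAt.comp (t, y) (g := (chartAt E x₀).symm) h1 h3))

theorem mfderiv_flow_chart (x₀ : M) (t : ℝ) {y : E} (hy : y ∈ (chartAt E x₀).target) :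
    mfderiv 𝓘(ℝ, E) 𝓘(ℝ, E) (Φ t ∘ (chartAt E x₀).symm) y =
      (mfderiv 𝓘(ℝ, ℝ × E) 𝓘(ℝ, E) (fun p : ℝ × E => Φ p.1 ((chartAt E x₀).symm p.2))
        (t, y)).comp (ContinuousLinearMap.inr ℝ ℝ E) := by
  have h1 : HasMFDerivAt 𝓘(ℝ, E) 𝓘(ℝ, ℝ × E) (fun z : E => (t, z)) y
      (ContinuousLinearMap.inr ℝ ℝ E) := (hasFDerivAt_prodMk_right t y).hasMFDerivAt
  have h2 := ((contMDiffAt_flow_chart hΦ x₀ t hy).mdifferentiableAt (by simp)).hasMFDerivAt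
  exact (HasMFDerivAt.comp y h2 h1).mfderiv

theorem mfderiv_flow_time (x₀ : M) (t : ℝ) {y : E} (hy : y ∈ (chartAt E x₀).target) :
    mfderiv 𝓘(ℝ, ℝ) 𝓘(ℝ, E) (fun s => Φ s ((chartAt E x₀).symm y)) t =
      (mfderiv 𝓘(ℝ, ℝ × E) 𝓘(ℝ, E) (fun p : ℝ × E => Φ p.1 ((chartAt E x₀).symm p.2))
        (t, y)).comp (ContinuousLinearMap.inl ℝ ℝ E) := by
  have h1 : HasMFDerivAt 𝓘(ℝ, ℝ) 𝓘(ℝ, ℝ × E) (fun s : ℝ => (s, y)) t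
      (ContinuousLinearMap.inl ℝ ℝ E) := (hasFDerivAt_prodMk_left t y).hasMFDerivAt
  have h2 := ((contMDiffAt_flow_chart hΦ x₀ t hy).mdifferentiableAt (by simp)).hasMFDerivAt
  exact (HasMFDerivAt.comp t h2 h1).mfderiv

/-- In a chart, `(Φ_t)^*α` is the restriction of the pull-back of `α` to the cylinder `ℝ × E` to the
slice with parameter `t`. -/
theorem inChart_pullback_flow (α : FormField E M k) (x₀ : M) (t : ℝ) {y : E}
    (hy : y ∈ (chartAt E x₀).target) :
    (pullback (Φ t) α).inChart x₀ y = (pullback (F := ℝ × E)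
      (fun p : ℝ × E => Φ p.1 ((chartAt E x₀).symm p.2)) α (t, y) :
        (ℝ × E) [⋀^Fin k]→L[ℝ] ℝ).compContinuousLinearMap (ContinuousLinearMap.inr ℝ ℝ E) := by
  rw [inChart_pullback α (contMDiff_flow hΦ t) x₀ hy]
  unfold pullback
  rw [mfderiv_flow_chart hΦ x₀ t hy]
  rfl

theorem inChart_flowContract (α : FormField E M (k + 1)) (x₀ : M) (t : ℝ) {y : E}
    (hy : y ∈ (chartAt E x₀).target) :
    (flowContract Φ α t).inChart x₀ y = (contract ((1 : ℝ), (0 : E)) (pullback (F := ℝ × E)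
      (fun p : ℝ × E => Φ p.1 ((chartAt E x₀).symm p.2)) α (t, y) :
        (ℝ × E) [⋀^Fin (k + 1)]→L[ℝ] ℝ)).compContinuousLinearMap
          (ContinuousLinearMap.inr ℝ ℝ E) := by
  have h1 := mfderiv_comp y ((contMDiff_flow hΦ t).mdifferentiableAt (by simp))
    (mdiff_chart_symm x₀ hy)
  rw [mfderiv_flow_chart hΦ x₀ t hy] at h1
  have h2 := congrArg (fun L : ℝ →L[ℝ] E => L 1) (mfderiv_flow_time hΦ x₀ t hy)
  ext v
  simp only [inChart, flowContract, pullback]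
  refine congrArg (α (Φ t ((chartAt E x₀).symm y))) (funext fun i => ?_)
  refine Fin.cases ?_ (fun j => ?_) i
  · exact h2
  · exact (congrArg (fun L : E →L[ℝ] E => L (v j)) h1).symm

variable {α : FormField E M k} (hα : α.IsSmooth)
include hα

theorem isSmoothFamily_pullback_flow :
    IsSmoothFamily (E := E) (M := M) fun t => pullback (Φ t) α := by
  intro x₀ p hp
  have h1 := contDiffAt_pullback hα (contMDiffAt_flow_chart hΦ x₀ p.1 hp.2)
  have h2 : ContDiff ℝ ∞ (compContinuousLinearMapCLM (ι := Fin k) (F := ℝ)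
      (ContinuousLinearMap.inr ℝ ℝ E)) := ContinuousLinearMap.contDiff (𝕜 := ℝ)
        (E := (ℝ × E) [⋀^Fin k]→L[ℝ] ℝ) (F := E [⋀^Fin k]→L[ℝ] ℝ) _
  exact (h2.contDiffAt.comp p h1).contDiffWithinAt.congr
    (fun q hq => inChart_pullback_flow hΦ α x₀ q.1 hq.2) (inChart_pullback_flow hΦ α x₀ p.1 hp.2)

end

section
variable {Φ : ℝ → M → M}
  (hΦ : ContMDiff (𝓘(ℝ, ℝ).prod 𝓘(ℝ, E)) 𝓘(ℝ, E) ∞ fun p : ℝ × M => Φ p.1 p.2)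
  {α : FormField E M (k + 1)} (hα : α.IsSmooth)
include hΦ hα

theorem isSmoothFamily_flowContract : IsSmoothFamily (flowContract Φ α) := by
  intro x₀ p hp
  have h1 := contDiffAt_pullback hα (contMDiffAt_flow_chart hΦ x₀ p.1 hp.2)
  have h2 : ContDiff ℝ ∞ (compContinuousLinearMapCLM (ι := Fin k) (F := ℝ)
      (ContinuousLinearMap.inr ℝ ℝ E)) := ContinuousLinearMap.contDiff (𝕜 := ℝ)
        (E := (ℝ × E) [⋀^Fin k]→L[ℝ] ℝ) (F := E [⋀^Fin k]→L[ℝ] ℝ) _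
  have h3 := (contractCLM k ((1 : ℝ), (0 : E))).contDiff (n := ∞)
  exact (h2.contDiffAt.comp p (h3.contDiffAt.comp p h1)).contDiffWithinAt.congr
    (fun q hq => inChart_flowContract hΦ α x₀ q.1 hq.2) (inChart_flowContract hΦ α x₀ p.1 hp.2)

end

/-- Cartan's formula on a cylinder: for a closed form `a` on `ℝ × E`, the `t`-derivative of its
restrictions to the slices is the exterior derivative of the restrictions of `ι_{∂_t} a`. -/
theorem hasDerivAt_slice_of_closed {a : ℝ × E → (ℝ × E) [⋀^Fin (k + 1)]→L[ℝ] ℝ} {t : ℝ} {y : E}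
    (ha : DifferentiableAt ℝ a (t, y)) (hd : extDeriv a (t, y) = 0) :
    HasDerivAt (fun s => (a (s, y)).compContinuousLinearMap (ContinuousLinearMap.inr ℝ ℝ E))
      (extDeriv (fun z => (contract ((1 : ℝ), (0 : E)) (a (t, z))).compContinuousLinearMap
        (ContinuousLinearMap.inr ℝ ℝ E)) y) t := by
  set a' := fderiv ℝ a (t, y) with ha'
  let P := compContinuousLinearMapCLM (𝕜 := ℝ) (ι := Fin (k + 1)) (F := ℝ)
      (ContinuousLinearMap.inr ℝ ℝ E)
  let Q := (compContinuousLinearMapCLM (𝕜 := ℝ) (ι := Fin k) (F := ℝ)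
      (ContinuousLinearMap.inr ℝ ℝ E)).comp (contractCLM k ((1 : ℝ), (0 : E)))
  have h1 : HasDerivAt (fun s => P (a (s, y))) (P (a' (1, 0))) t := by
    have := (ha.hasFDerivAt.comp t (hasFDerivAt_prodMk_left t y)).hasDerivAt
    exact (ContinuousLinearMap.hasFDerivAt (𝕜 := ℝ) (E := (ℝ × E) [⋀^Fin (k + 1)]→L[ℝ] ℝ)
      (F := E [⋀^Fin (k + 1)]→L[ℝ] ℝ) P).comp_hasDerivAt t this
  have h2 : HasFDerivAt (fun z => Q (a (t, z)))
      (Q.comp (a'.comp (ContinuousLinearMap.inr ℝ ℝ E))) y := by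
    have := ha.hasFDerivAt.comp y (hasFDerivAt_prodMk_right t y)
    exact (ContinuousLinearMap.hasFDerivAt (𝕜 := ℝ) (E := (ℝ × E) [⋀^Fin (k + 1)]→L[ℝ] ℝ)
      (F := E [⋀^Fin k]→L[ℝ] ℝ) Q).comp y this
  convert! h1 using 1
  rw [extDeriv]
  refine (congrArg alternatizeUncurryFin h2.fderiv).trans ?_
  ext v
  -- evaluate `da = 0` on `∂_t` followed by vectors tangent to the slice
  have h3 := congrArg (fun b : (ℝ × E) [⋀^Fin (k + 2)]→L[ℝ] ℝ =>
    b (Fin.cons ((1 : ℝ), (0 : E)) (ContinuousLinearMap.inr ℝ ℝ E ∘ v))) hd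
  simp only [extDeriv, alternatizeUncurryFin_apply] at h3
  rw [Fin.sum_univ_succ] at h3
  have h4 : ∀ i : Fin (k + 1), a' (ContinuousLinearMap.inr ℝ ℝ E (v i)) (i.succ.removeNth
      (Fin.cons ((1 : ℝ), (0 : E)) (ContinuousLinearMap.inr ℝ ℝ E ∘ v) :
        Fin (k + 2) → ℝ × E)) = Q (a' (ContinuousLinearMap.inr ℝ ℝ E (v i))) (i.removeNth v) := by
    intro i
    refine congrArg (a' (ContinuousLinearMap.inr ℝ ℝ E (v i))) (funext fun j => ?_)
    refine j.cases ?_ (fun j => ?_)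
    · simp [Fin.removeNth]
    · simp [Fin.removeNth]
  simp only [Fin.cons_zero, Fin.cons_succ, Function.comp_apply, Fin.val_succ, pow_succ,
    Fin.val_zero, pow_zero, one_smul, mul_neg_one, neg_smul, Finset.sum_neg_distrib] at h3
  rw [alternatizeUncurryFin_apply]
  refine Eq.trans ?_ (sub_eq_zero.1 ((sub_eq_add_neg _ _).trans h3)).symm
  exact Finset.sum_congr rfl fun i _ => congrArg ((-1 : ℤ) ^ (i : ℕ) • ·) (h4 i).symm

variable {Φ : ℝ → M → M}
  (hΦ : ContMDiff (𝓘(ℝ, ℝ).prod 𝓘(ℝ, E)) 𝓘(ℝ, E) ∞ fun p : ℝ × M => Φ p.1 p.2)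
  {α : FormField E M (k + 1)}
include hΦ

/-- For a closed form, `∂_t (Φ_t)^*α` is exact, with primitive the contraction with the velocity. -/
theorem hasDerivAt_pullback_flow (hα : α.IsSmooth) (hd : α.extDer = 0) (x : M) (t : ℝ) :
    HasDerivAt (F := E [⋀^Fin (k + 1)]→L[ℝ] ℝ) (fun s => pullback (Φ s) α x)
      ((flowContract Φ α t).extDer x) t := by
  have hy := (chartAt E x).map_source (mem_chart_source E x)
  set y := chartAt E x x with hy'
  have hf := contMDiffAt_flow_chart hΦ x t hy
  have h1 := (contDiffAt_pullback hα hf).differentiableAt (by simp)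
  have h2 := hasDerivAt_slice_of_closed h1 (by
    rw [FormField.extDeriv_pullback hα hf, hd]; rfl)
  have h3 : HasDerivAt (fun s => (pullback (Φ s) α).inChart x y)
      ((flowContract Φ α t).extDer.inChart x y) t := by
    rw [inChart_extDer ((isSmoothFamily_flowContract hΦ hα).isSmooth t) x hy]
    convert! h2 using 1
    · exact funext fun s => inChart_pullback_flow hΦ α x s hy
    · refine Filter.EventuallyEq.extDeriv_eq ?_
      filter_upwards [(chartAt E x).open_target.mem_nhds hy] with z hz
      exact inChart_flowContract hΦ α x t hz
  let L := compContinuousLinearMapCLM (𝕜 := ℝ) (ι := Fin (k + 1)) (F := ℝ)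
    (mfderiv 𝓘(ℝ, E) 𝓘(ℝ, E) (chartAt E x) x : E →L[ℝ] E)
  have h4 := (ContinuousLinearMap.hasFDerivAt (𝕜 := ℝ) (E := E [⋀^Fin (k + 1)]→L[ℝ] ℝ)
      (F := E [⋀^Fin (k + 1)]→L[ℝ] ℝ) L).comp_hasDerivAt t h3
  exact (congrArg₂ (fun f f' => HasDerivAt (F := E [⋀^Fin (k + 1)]→L[ℝ] ℝ) f f' t)
    (funext fun s => eq_inChart_comp (pullback (Φ s) α) x)
    (eq_inChart_comp (flowContract Φ α t).extDer x)).mpr h4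

/-- The homotopy formula: the average of a closed form `α` over `0 ≤ t ≤ 1` differs from `Φ_0^*α` by
the differential of `∫₀¹ (1 - t) ι_t dt`, with `ι_t` the contraction with the velocity. -/
theorem integral_pullback_flow (hα : α.IsSmooth) (hd : α.extDer = 0) :
    integral (E := E) (M := M) (fun t => pullback (Φ t) α) = pullback (Φ 0) α +
      (integral fun t => (1 - t) • flowContract Φ α t).extDer := by
  have hw : ContDiff ℝ ∞ fun t : ℝ => 1 - t := contDiff_const.sub contDiff_id
  have hF := isSmoothFamily_flowContract hΦ hα
  have hP := isSmoothFamily_pullback_flow hΦ hα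
  rw [extDer_integral (hF.smul hw)]
  funext x
  refine (intervalIntegral_eq_add_integral_one_sub_smul (G := E [⋀^Fin (k + 1)]→L[ℝ] ℝ)
    (hasDerivAt_pullback_flow hΦ hα hd x) (hF.extDer.continuous_apply x)).trans ?_
  simp only [extDer_smul]
  rfl

/-- Closed `0`-forms are constant along smooth families of maps. -/
theorem pullback_flow_eq_of_closed {α : FormField E M 0} (hα : α.IsSmooth) (hd : α.extDer = 0)
    (t : ℝ) : (pullback (Φ t) α : FormField E M 0) = pullback (Φ 0) α := by
  funext x
  have h0 : ∀ s : ℝ, HasDerivAt (F := E [⋀^Fin 0]→L[ℝ] ℝ) (fun s => pullback (Φ s) α x) 0 s := by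
    intro s
    have hy := (chartAt E x).map_source (mem_chart_source E x)
    have hf := contMDiffAt_flow_chart hΦ x s hy
    set y := chartAt E x x
    have h1 := (contDiffAt_pullback hα hf).differentiableAt (by simp)
    have h2 : extDeriv (E := ℝ × E) (pullback (F := ℝ × E)
        (fun p : ℝ × E => Φ p.1 ((chartAt E x).symm p.2)) α) (s, y) = 0 := by
      rw [FormField.extDeriv_pullback hα hf, hd]
      rfl
    have h3 := (h1.hasFDerivAt.comp s (hasFDerivAt_prodMk_left s y)).hasDerivAt
    have h4 : fderiv (F := (ℝ × E) [⋀^Fin 0]→L[ℝ] ℝ) ℝ (pullback (F := ℝ × E)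
        (fun p : ℝ × E => Φ p.1 ((chartAt E x).symm p.2)) α) (s, y) ((1 : ℝ), (0 : E)) = 0 := by
      ext v
      have h5 := congrArg (fun b : (ℝ × E) [⋀^Fin 1]→L[ℝ] ℝ => b (fun _ => (1, 0))) h2
      simp only [extDeriv, alternatizeUncurryFin_apply] at h5
      rw [Subsingleton.elim v (Fin.removeNth 0 fun _ : Fin 1 => ((1 : ℝ), (0 : E)))]
      simpa using h5
    let L := (compContinuousLinearMapCLM (𝕜 := ℝ) (ι := Fin 0) (F := ℝ)
      (mfderiv 𝓘(ℝ, E) 𝓘(ℝ, E) (chartAt E x) x : E →L[ℝ] E)).comp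
        (compContinuousLinearMapCLM (𝕜 := ℝ) (ι := Fin 0) (F := ℝ)
          (ContinuousLinearMap.inr ℝ ℝ E))
    have h5 := (ContinuousLinearMap.hasFDerivAt (𝕜 := ℝ) (E := (ℝ × E) [⋀^Fin 0]→L[ℝ] ℝ)
      (F := E [⋀^Fin 0]→L[ℝ] ℝ) L).comp_hasDerivAt s h3
    refine (congrArg₂ (fun f f' => HasDerivAt (F := E [⋀^Fin 0]→L[ℝ] ℝ) f f' s)
      (funext fun r => ?_) ?_).mpr h5
    · refine (eq_inChart_comp (pullback (Φ r) α) x).trans ?_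
      rw [inChart_pullback_flow hΦ α x r hy]
      rfl
    · exact ((congrArg L h4).trans (map_zero L)).symm
  exact is_const_of_deriv_eq_zero (G := E [⋀^Fin 0]→L[ℝ] ℝ) (fun s => (h0 s).differentiableAt)
    (fun s => (h0 s).deriv) t 0

end Flow
end FormField

/-! ### Averages of basic forms along a periodic flow -/

theorem Function.Periodic.intervalIntegral_comp_add_right {G : Type*} [NormedAddCommGroup G]
    [NormedSpace ℝ G] {c : ℝ → G} (hc : Function.Periodic c 1) (s : ℝ) :
    ∫ t in (0 : ℝ)..1, c (t + s) = ∫ t in (0 : ℝ)..1, c t := by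
  rw [intervalIntegral.integral_comp_add_right, zero_add, add_comm 1 s,
    hc.intervalIntegral_add_eq s 0, zero_add]

namespace FormField
section BasicAverage
universe u
variable {E : Type u} [NormedAddCommGroup E] [NormedSpace ℝ E]
  {M : Type*} [TopologicalSpace M] [ChartedSpace E M] {k : ℕ}
  {R : ∀ x : M, TangentSpace 𝓘(ℝ, E) x}

theorem pullback_id (α : FormField E M k) : pullback id α = α := by
  funext x
  unfold pullback
  rw [mfderiv_id]
  rfl

theorem pullback_pullback {f g : M → M} (hf : ContMDiff 𝓘(ℝ, E) 𝓘(ℝ, E) ∞ f)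
    (hg : ContMDiff 𝓘(ℝ, E) 𝓘(ℝ, E) ∞ g) (α : FormField E M k) :
    pullback (F := E) (E := E) g (pullback (F := E) f α) = pullback (f ∘ g) α := by
  funext x
  unfold pullback
  rw [mfderiv_comp x (hf.mdifferentiableAt (by simp)) (hg.mdifferentiableAt (by simp))]
  rfl

theorem IsHorizontal.pullback {f : M → M}
    (hf : ∀ x, mfderiv 𝓘(ℝ, E) 𝓘(ℝ, E) f x (R x) = R (f x)) {α : FormField E M k}
    (hα : α.IsHorizontal R) : IsHorizontal R (pullback f α) := by
  rw [isHorizontal_iff] at *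
  intro x v i hi
  exact hα (f x) _ i ((congrArg (mfderiv 𝓘(ℝ, E) 𝓘(ℝ, E) f x) hi).trans (hf x))

theorem IsHorizontal.sub {α β : FormField E M k} (hα : α.IsHorizontal R) (hβ : β.IsHorizontal R) :
    (α - β).IsHorizontal R := by
  rw [isHorizontal_iff] at *
  exact fun x v i hi => (congrArg₂ (· - ·) (hα x v i hi) (hβ x v i hi)).trans (sub_zero 0)

/-- Contractions of a horizontal form are horizontal, since `ι_R ι_X = -ι_X ι_R`. -/
theorem IsHorizontal.flowContract {Φ : ℝ → M → M} {t : ℝ}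
    (hR : ∀ x, mfderiv 𝓘(ℝ, E) 𝓘(ℝ, E) (Φ t) x (R x) = R (Φ t x)) {α : FormField E M (k + 1)}
    (hα : α.IsHorizontal R) : (flowContract Φ α t).IsHorizontal R := by
  rw [isHorizontal_iff] at *
  intro x v i hi
  exact hα (Φ t x) _ i.succ ((congrArg (mfderiv 𝓘(ℝ, E) 𝓘(ℝ, E) (Φ t) x) hi).trans (hR x))

variable [IsManifold 𝓘(ℝ, E) ∞ M] {Φ : ℝ → M → M}
  (hΦ : ContMDiff (𝓘(ℝ, ℝ).prod 𝓘(ℝ, E)) 𝓘(ℝ, E) ∞ fun p : ℝ × M => Φ p.1 p.2)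
include hΦ

/-- The average of `(Φ_t)^*α` over `0 ≤ t ≤ 1`. -/
noncomputable def average (α : smooth E M k) : smooth E M k :=
  ⟨integral fun t => pullback (Φ t) α.1,
    isSmooth_integral (isSmoothFamily_pullback_flow hΦ (smooth.isSmooth α))⟩

theorem dLin_average (α : smooth E M k) :
    dLin E M k (average hΦ α) = average hΦ (dLin E M k α) := by
  refine Subtype.ext ((extDer_integral (isSmoothFamily_pullback_flow hΦ
    (smooth.isSmooth α))).trans (integral_congr fun t => ?_))
  exact extDer_pullback (smooth.isSmooth α) (contMDiff_flow hΦ t)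

omit hΦ [IsManifold 𝓘(ℝ, E) ∞ M] in
theorem integral_const (α : FormField E M k) : integral (fun _ => α) = α := by
  funext x
  refine (intervalIntegral.integral_const (E := E [⋀^Fin k]→L[ℝ] ℝ) _).trans ?_
  rw [sub_zero]
  exact one_smul ℝ (α x : E [⋀^Fin k]→L[ℝ] ℝ)

theorem average_eq_self {α : smooth E M k} (h : ∀ t, pullback (Φ t) α.1 = α.1) :
    average hΦ α = α :=
  Subtype.ext ((integral_congr h).trans (integral_const α.1))

/-- Averaging preserves invariance under maps that commute with the flow. -/
theorem pullback_average {α : smooth E M k} {f : M → M} (hf : ContMDiff 𝓘(ℝ, E) 𝓘(ℝ, E) ∞ f)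
    (h : ∀ t, Φ t ∘ f = f ∘ Φ t) (hα : pullback f α.1 = α.1) :
    pullback f (average hΦ α).1 = (average hΦ α).1 := by
  refine (pullback_integral (isSmoothFamily_pullback_flow hΦ (smooth.isSmooth α)) f).trans
    (integral_congr fun t => ?_)
  rw [pullback_pullback (contMDiff_flow hΦ t) hf, h t,
    ← pullback_pullback hf (contMDiff_flow hΦ t), hα]

/-- The average over a period of a flow is invariant under the flow. -/
theorem pullback_average_self (h1 : ∀ t, Φ (t + 1) = Φ t) (hadd : ∀ s t, Φ (s + t) = Φ s ∘ Φ t)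
    (α : smooth E M k) (s : ℝ) : pullback (Φ s) (average hΦ α).1 = (average hΦ α).1 := by
  refine (pullback_integral (isSmoothFamily_pullback_flow hΦ (smooth.isSmooth α)) (Φ s)).trans ?_
  have h2 : ∀ t, pullback (F := E) (E := E) (Φ s) (pullback (F := E) (Φ t) α.1) =
      pullback (Φ (t + s)) α.1 := fun t => by
    rw [pullback_pullback (contMDiff_flow hΦ t) (contMDiff_flow hΦ s), hadd]
  rw [integral_congr h2]
  funext x
  exact Function.Periodic.intervalIntegral_comp_add_right (G := E [⋀^Fin k]→L[ℝ] ℝ)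
    (c := fun t => pullback (Φ t) α.1 x)
    (fun t => congrArg (fun f : M → M => pullback f α.1 x) (h1 t)) s

theorem isBasic_average (hR : ∀ t x, mfderiv 𝓘(ℝ, E) 𝓘(ℝ, E) (Φ t) x (R x) = R (Φ t x))
    {α : smooth E M k} (hα : α.1.IsBasic R) : (average hΦ α).1.IsBasic R := by
  have hP := isSmoothFamily_pullback_flow hΦ (smooth.isSmooth α)
  refine ⟨IsHorizontal.integral hP fun t => hα.1.pullback (hR t), ?_⟩
  have h1 : (average hΦ α).1.extDer = (average hΦ (dLin E M k α)).1 :=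
    congrArg Subtype.val (dLin_average hΦ α)
  rw [h1]
  exact IsHorizontal.integral (isSmoothFamily_pullback_flow hΦ (smooth.isSmooth (dLin E M k α)))
    fun t => hα.2.pullback (hR t)

/-- The homotopy operator `∫₀¹ (1 - t) ι_t dt`, with `ι_t` the contraction of `(Φ_t)^*α` with the
velocity of `Φ`. -/
noncomputable def homotopy (α : smooth E M (k + 1)) : smooth E M k :=
  ⟨integral fun t => (1 - t) • flowContract Φ α.1 t,
    isSmooth_integral ((isSmoothFamily_flowContract hΦ (smooth.isSmooth α)).smul
      (contDiff_const.sub contDiff_id))⟩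

theorem average_eq_add_dLin_homotopy (h0 : Φ 0 = id) {α : smooth E M (k + 1)}
    (hα : dLin E M (k + 1) α = 0) :
    average hΦ α = α + dLin E M k (homotopy hΦ α) := by
  refine Subtype.ext ((integral_pullback_flow hΦ (smooth.isSmooth α)
    (congrArg Subtype.val hα)).trans ?_)
  rw [h0, pullback_id]
  rfl

/-- The differential of the homotopy is horizontal since it is a difference of horizontal forms; so
no bracket relation between `R` and the velocity of `Φ` enters. -/
theorem isBasic_homotopy (h0 : Φ 0 = id)
    (hR : ∀ t x, mfderiv 𝓘(ℝ, E) 𝓘(ℝ, E) (Φ t) x (R x) = R (Φ t x))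
    {α : smooth E M (k + 1)} (hα : α.1.IsBasic R) (hd : dLin E M (k + 1) α = 0) :
    (homotopy hΦ α).1.IsBasic R := by
  have hF := (isSmoothFamily_flowContract hΦ (smooth.isSmooth α)).smul
      (w := fun t => 1 - t) (contDiff_const.sub contDiff_id)
  refine ⟨IsHorizontal.integral hF fun t => (hα.1.flowContract (hR t)).smul _, ?_⟩
  have h1 : (average hΦ α).1 = α.1 + (homotopy hΦ α).1.extDer :=
    congrArg Subtype.val (average_eq_add_dLin_homotopy hΦ h0 hd)
  have h2 : (homotopy hΦ α).1.extDer = (average hΦ α).1 - α.1 := eq_sub_of_add_eq' h1.symm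
  rw [h2]
  exact (isBasic_average hΦ hR hα).1.sub hα.1

end BasicAverage
end FormField

/-! ### Diffeomorphisms preserving a cosymplectic structure preserve its Reeb field -/

section ReebUnique

/-- A form of top degree annihilated by a nonzero vector `u` vanishes: evaluate it on a basis that
contains `u`. -/
theorem ContinuousAlternatingMap.eq_zero_of_apply_eq_zero {V : Type*} [AddCommGroup V]
    [Module ℝ V] [TopologicalSpace V] [FiniteDimensional ℝ V] {N : ℕ}
    (hN : Module.finrank ℝ V = N) {u : V} (hu : u ≠ 0)
    (a : V [⋀^Fin N]→L[ℝ] ℝ) (ha : ∀ v i, v i = u → a v = 0) : a = 0 := by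
  have hs : LinearIndepOn ℝ id ({u} : Set V) := LinearIndepOn.singleton hu
  let b := Module.Basis.extend hs
  have e := b.indexEquiv (Module.finBasisOfFinrankEq ℝ V hN)
  let b' := b.reindex e
  have hmem : u ∈ hs.extend (Set.subset_univ _) := hs.subset_extend _ rfl
  have h1 : b' (e ⟨u, hmem⟩) = u := by simp [b', b]
  have h2 : a.toAlternatingMap = 0 := by
    by_contra h
    exact (a.toAlternatingMap.map_basis_ne_zero_iff b').2 h (ha b' _ h1)
  ext v
  exact congrArg (fun f => f v) h2

variable {n : ℕ} {M : Type*} [TopologicalSpace M]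
  {E : Type*} [NormedAddCommGroup E] [NormedSpace ℝ E] [ChartedSpace E M]
  [IsManifold 𝓘(ℝ, E) ∞ M] {η : FormField.smooth E M 1} {ω₂ : FormField.smooth E M 2}

theorem powTwo_apply_eq_zero {x : M} {u : TangentSpace 𝓘(ℝ, E) x}
    (hu : ∀ v i, v i = u → ω₂.1 x v = 0) (n : ℕ) (v : Fin (2 * n) → TangentSpace 𝓘(ℝ, E) x)
    (i : Fin (2 * n)) (hi : v i = u) :
    (show FormField.smooth E M (2 * n) from (deRham E M).powTwo ω₂ n).1 x v = 0 := by
  induction n with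
  | zero => exact absurd i.2 (by simp)
  | succ n ih =>
    exact wedge_eq_zero_of_mem (Nat.mul_succ 2 n).symm _ (ω₂.1 x) u ih hu v i hi

/-- A vector annihilated by `η` and `ω` vanishes, since it is annihilated by the volume form. -/
theorem IsCosymplectic.eq_zero (hE : Module.finrank ℝ E = 2 * n + 1)
    (hcos : IsCosymplectic n η ω₂) {x : M} {u : TangentSpace 𝓘(ℝ, E) x} (h1 : η.1 x ![u] = 0)
    (h2 : ∀ v, ω₂.1 x ![u, v] = 0) : u = 0 := by
  by_contra hu
  have : FiniteDimensional ℝ E := Module.finite_of_finrank_pos (by omega)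
  refine hcos.volume_ne_zero x
    (ContinuousAlternatingMap.eq_zero_of_apply_eq_zero (V := E) hE hu _ ?_)
  refine fun v i hi => wedge_eq_zero_of_mem (Nat.add_comm 1 (2 * n)) _ _ u ?_
    (powTwo_apply_eq_zero ?_ n) v i hi
  · intro w j hj
    rw [show w = ![u] from funext fun l => by
      rw [Subsingleton.elim l j, hj, Subsingleton.elim j 0]; rfl]
    exact h1
  · intro w j hj
    have h3 : ∀ w : Fin 2 → TangentSpace 𝓘(ℝ, E) x, w 0 = u → ω₂.1 x w = 0 := fun w hw => by
      rw [show w = ![u, w 1] from funext fun l => by fin_cases l <;> simp [hw]]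
      exact h2 (w 1)
    by_cases hj0 : j = 0
    · exact h3 w (hj0 ▸ hj)
    · have h4 := (ω₂.1 x).toAlternatingMap.map_swap w (Ne.symm hj0)
      exact neg_eq_zero.1 (h4.symm.trans (h3 _ (by simp [hj])))

/-- Diffeomorphisms preserving the cosymplectic structure preserve its Reeb field. -/
theorem IsReebField.mfderiv_apply (hE : Module.finrank ℝ E = 2 * n + 1)
    (hcos : IsCosymplectic n η ω₂) {R : ∀ x : M, TangentSpace 𝓘(ℝ, E) x}
    (hR : IsReebField η ω₂ R) {f g : M → M} (hf : ContMDiff 𝓘(ℝ, E) 𝓘(ℝ, E) ∞ f)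
    (hg : ContMDiff 𝓘(ℝ, E) 𝓘(ℝ, E) ∞ g) (hfg : f ∘ g = id) (hgf : g ∘ f = id)
    (hη : FormField.pullback f η.1 = η.1) (hω : FormField.pullback f ω₂.1 = ω₂.1) (x : M) :
    mfderiv 𝓘(ℝ, E) 𝓘(ℝ, E) f x (R x) = R (f x) := by
  set W := mfderiv 𝓘(ℝ, E) 𝓘(ℝ, E) f x (R x) with hW
  have h1 : η.1 (f x) ![W] = 1 := by
    have h := congrArg (fun a : FormField E M 1 => a x ![R x]) hη
    refine Eq.trans ?_ (h.trans (hR x).1)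
    exact congrArg (η.1 (f x)) (funext fun i => by rw [Subsingleton.elim i 0]; rfl)
  have hsurj : ∀ v : TangentSpace 𝓘(ℝ, E) (f x), ∃ w, mfderiv 𝓘(ℝ, E) 𝓘(ℝ, E) f x w = v := by
    intro v
    have hx : g (f x) = x := congrFun hgf x
    have h2 := mfderiv_comp (f x) (hf.mdifferentiableAt (x := g (f x)) (by simp))
      (hg.mdifferentiableAt (x := f x) (by simp))
    rw [hfg, mfderiv_id, hx] at h2
    exact ⟨mfderiv 𝓘(ℝ, E) 𝓘(ℝ, E) g (f x) v, (congrArg (fun L : E →L[ℝ] E => L v) h2).symm⟩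
  have h2 : ∀ v, ω₂.1 (f x) ![W, v] = 0 := by
    intro v
    obtain ⟨w, rfl⟩ := hsurj v
    have h := congrArg (fun a : FormField E M 2 => a x ![R x, w]) hω
    refine Eq.trans ?_ (h.trans ((hR x).2 w))
    exact congrArg (ω₂.1 (f x)) (funext fun i => by fin_cases i <;> rfl)
  -- `η` and `ω` do not distinguish the image `W` of `R x` from `R (f x)`
  refine sub_eq_zero.1 (hcos.eq_zero hE ?_ fun v => ?_)
  · have h3 := (η.1 (f x)).map_update_sub ![W] 0 W (R (f x))
    have e : ∀ y, Function.update ![W] 0 y = ![y] := fun y => funext fun i => by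
      fin_cases i; rfl
    simp only [e] at h3
    rw [h3, h1, (hR (f x)).1, sub_self]
  · have h3 := (ω₂.1 (f x)).map_update_sub ![W, v] 0 W (R (f x))
    have e : ∀ y, Function.update ![W, v] 0 y = ![y, v] := fun y => funext fun i => by
      fin_cases i <;> rfl
    simp only [e] at h3
    rw [h3, h2, (hR (f x)).2, sub_self]

end ReebUnique

/-! ### Quasi-isomorphisms in terms of elements -/

section QuasiIso
open CategoryTheory HomologicalComplex
universe u

/-- Pointwise preimages under a linear map of vector spaces can be chosen linearly. -/
theorem LinearMap.exists_comp_eq_of_range_le {K V W X : Type*} [Field K] [AddCommGroup V]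
    [Module K V] [AddCommGroup W] [Module K W] [AddCommGroup X] [Module K X] (g : V →ₗ[K] W)
    (f : X →ₗ[K] W) (h : ∀ x, ∃ v, g v = f x) : ∃ l : X →ₗ[K] V, g ∘ₗ l = f := by
  obtain ⟨l, hl⟩ := Module.projective_lifting_property g.rangeRestrict
    (f.codRestrict (LinearMap.range g) h) g.surjective_rangeRestrict
  exact ⟨l, LinearMap.ext fun x => congrArg Subtype.val (LinearMap.congr_fun hl x)⟩

namespace DGAlgebra

theorem toCochainComplex_d (A : DGAlgebra.{u}) (k : ℕ) :
    A.toCochainComplex.d k (k + 1) = ModuleCat.ofHom (A.d k) := by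
  simp only [toCochainComplex, CochainComplex.of_d]

theorem toCochainComplex_d_zero (A : DGAlgebra.{u}) : A.toCochainComplex.d 0 0 = 0 :=
  A.toCochainComplex.shape 0 0 (by simp)

namespace Hom
variable {A B : DGAlgebra.{u}} (f : Hom A B)

theorem mono_homologyMap (inj0 : ∀ a : A.X 0, A.d 0 a = 0 → f.toLin 0 a = 0 → a = 0)
    (inj : ∀ (k : ℕ) (a : A.X (k + 1)) (b : B.X k), A.d (k + 1) a = 0 →
      f.toLin (k + 1) a = B.d k b → ∃ a' : A.X k, A.d k a' = a) (j : ℕ) :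
    Mono (homologyMap f.toCochainMap j) := by
  cases j with
  | zero =>
    rw [mono_homologyMap_iff_up_to_refinements f.toCochainMap 0 0 1 (by simp) (by simp)]
    intro Z z hz y hy
    rw [toCochainComplex_d] at hz
    rw [toCochainComplex_d_zero, Limits.comp_zero] at hy
    refine ⟨Z, 𝟙 Z, inferInstance, 0, ?_⟩
    rw [Limits.zero_comp, Category.id_comp]
    ext x
    exact inj0 (z.hom x) (congrArg (fun g => g.hom x) hz) (congrArg (fun g => g.hom x) hy)
  | succ k =>
    rw [mono_homologyMap_iff_up_to_refinements f.toCochainMap k (k + 1) (k + 2) (by simp)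
      (by simp)]
    intro Z z hz y hy
    rw [toCochainComplex_d] at hz hy
    obtain ⟨l, hl⟩ := (A.d k).exists_comp_eq_of_range_le (X := Z) z.hom fun x =>
      inj k (z.hom x) (y.hom x) (congrArg (fun g => g.hom x) hz) (congrArg (fun g => g.hom x) hy)
    refine ⟨Z, 𝟙 Z, inferInstance, ModuleCat.ofHom l, ?_⟩
    rw [toCochainComplex_d, Category.id_comp]
    ext x
    exact (LinearMap.congr_fun hl x).symm

theorem epi_homologyMap
    (surj0 : ∀ b : B.X 0, B.d 0 b = 0 → ∃ a : A.X 0, A.d 0 a = 0 ∧ f.toLin 0 a = b)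
    (surj : ∀ (k : ℕ) (b : B.X (k + 1)), B.d (k + 1) b = 0 →
      ∃ (a : A.X (k + 1)) (b' : B.X k), A.d (k + 1) a = 0 ∧ f.toLin (k + 1) a = b + B.d k b')
    (j : ℕ) : Epi (homologyMap f.toCochainMap j) := by
  cases j with
  | zero =>
    rw [epi_homologyMap_iff_up_to_refinements f.toCochainMap 0 0 1 (by simp) (by simp)]
    intro Z y hy
    rw [toCochainComplex_d] at hy
    obtain ⟨l, hl⟩ := ((A.d 0).prod (f.toLin 0)).exists_comp_eq_of_range_le (X := Z)
      ((0 : Z →ₗ[ℝ] A.X 1).prod y.hom) fun x => by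
        obtain ⟨a, h1, h2⟩ := surj0 (y.hom x) (congrArg (fun g => g.hom x) hy)
        exact ⟨a, Prod.ext h1 h2⟩
    refine ⟨Z, 𝟙 Z, inferInstance, ModuleCat.ofHom l, ?_, 0, ?_⟩
    · rw [toCochainComplex_d]
      ext x
      exact congrArg Prod.fst (LinearMap.congr_fun hl x)
    · rw [Limits.zero_comp, Category.id_comp, add_zero]
      ext x
      exact (congrArg Prod.snd (LinearMap.congr_fun hl x)).symm
  | succ k =>
    rw [epi_homologyMap_iff_up_to_refinements f.toCochainMap k (k + 1) (k + 2) (by simp)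
      (by simp)]
    intro Z y hy
    rw [toCochainComplex_d] at hy
    obtain ⟨l, hl⟩ := ((A.d (k + 1) ∘ₗ LinearMap.fst ℝ _ _).prod
      ((f.toLin (k + 1)).coprod (B.d k))).exists_comp_eq_of_range_le (X := Z)
        ((0 : Z →ₗ[ℝ] A.X (k + 2)).prod y.hom) fun x => by
          obtain ⟨a, b, h1, h2⟩ := surj k (y.hom x) (congrArg (fun g => g.hom x) hy)
          refine ⟨(a, -b), Prod.ext h1 ?_⟩
          change f.toLin (k + 1) a + B.d k (-b) = y.hom x
          rw [h2, map_neg]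
          exact add_neg_cancel_right (G := B.X (k + 1)) (y.hom x) (B.d k b)
    refine ⟨Z, 𝟙 Z, inferInstance, ModuleCat.ofHom (LinearMap.fst ℝ _ _ ∘ₗ l), ?_,
      ModuleCat.ofHom (LinearMap.snd ℝ _ _ ∘ₗ l), ?_⟩
    · rw [toCochainComplex_d]
      ext x
      exact congrArg Prod.fst (LinearMap.congr_fun hl x)
    · rw [toCochainComplex_d, Category.id_comp]
      ext x
      exact (congrArg Prod.snd (LinearMap.congr_fun hl x)).symm

/-- A criterion on elements for a morphism of differential graded algebras to be a
quasi-isomorphism; degree `0` is separate as no differential arrives there. -/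
theorem isQuasiIso_of_elements
    (inj0 : ∀ a : A.X 0, A.d 0 a = 0 → f.toLin 0 a = 0 → a = 0)
    (inj : ∀ (k : ℕ) (a : A.X (k + 1)) (b : B.X k), A.d (k + 1) a = 0 →
      f.toLin (k + 1) a = B.d k b → ∃ a' : A.X k, A.d k a' = a)
    (surj0 : ∀ b : B.X 0, B.d 0 b = 0 → ∃ a : A.X 0, A.d 0 a = 0 ∧ f.toLin 0 a = b)
    (surj : ∀ (k : ℕ) (b : B.X (k + 1)), B.d (k + 1) b = 0 →
      ∃ (a : A.X (k + 1)) (b' : B.X k), A.d (k + 1) a = 0 ∧ f.toLin (k + 1) a = b + B.d k b') :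
    f.IsQuasiIso := by
  refine ⟨fun j => ?_⟩
  rw [quasiIsoAt_iff_isIso_homologyMap]
  have := f.mono_homologyMap inj0 inj j
  have := f.epi_homologyMap surj0 surj j
  exact isIso_of_mono_of_epi _

end Hom
end DGAlgebra
end QuasiIso

/-! ### The circle factors of a torus -/

section Torus
variable {m : ℕ}

/-- The `j`-th circle of the torus `(S¹)^m`, parametrized with period `1`. -/
noncomputable def torusCircle (j : Fin m) (t : ℝ) : Fin m → Circle :=
  Pi.mulSingle j (Circle.exp (2 * Real.pi * t))

theorem torusCircle_zero (j : Fin m) : torusCircle j 0 = 1 := by simp [torusCircle]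

theorem torusCircle_add (j : Fin m) (s t : ℝ) :
    torusCircle j (s + t) = torusCircle j s * torusCircle j t := by
  rw [torusCircle, mul_add, Circle.exp_add, Pi.mulSingle_mul]; rfl

theorem torusCircle_add_one (j : Fin m) (t : ℝ) : torusCircle j (t + 1) = torusCircle j t := by
  rw [torusCircle, mul_add, mul_one, Circle.exp_add_two_pi]; rfl

theorem contMDiff_torusCircle (j : Fin m) :
    ContMDiff 𝓘(ℝ, ℝ) (ModelWithCorners.pi fun _ : Fin m => 𝓡 1) ∞ (torusCircle j) := by
  have h1 : ∀ i, ContMDiff 𝓘(ℝ, ℝ) (𝓡 1) ∞ fun t => torusCircle j t i := by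
    intro i
    by_cases h : i = j
    · subst h
      simp only [torusCircle, Pi.mulSingle_eq_same]
      exact contMDiff_circleExp.comp (contDiff_const.mul contDiff_id).contMDiff
    · simp only [torusCircle, Pi.mulSingle_eq_of_ne h]
      exact contMDiff_const
  -- the charts of a product manifold are the products of the charts of the factors
  intro t
  rw [contMDiffAt_iff]
  refine ⟨continuousAt_pi.2 fun i => (h1 i).continuous.continuousAt, ?_⟩
  refine contDiffWithinAt_pi.2 fun i => ?_
  exact (contMDiffAt_iff.1 (h1 i t)).2

/-- The torus is generated by its circle factors. -/
theorem torus_induction {p : (Fin m → Circle) → Prop} (h1 : p 1)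
    (hmul : ∀ g h, p g → p h → p (g * h)) (hc : ∀ j t, p (torusCircle j t)) (g : Fin m → Circle) :
    p g := by
  rw [← Finset.univ_prod_mulSingle g]
  refine Finset.prod_induction _ p hmul h1 fun j _ => ?_
  have h := hc j ((g j : ℂ).arg / (2 * Real.pi))
  rwa [torusCircle, mul_div_cancel₀ _ (by positivity), Circle.exp_arg] at h

end Torus

/-! ### Invariant representatives of basic cohomology classes -/

section TorusAverage
open FormField
universe u
variable {m : ℕ} {E : Type u} [NormedAddCommGroup E] [NormedSpace ℝ E]
  {M : Type*} [TopologicalSpace M] [ChartedSpace E M] [IsManifold 𝓘(ℝ, E) ∞ M]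
  [MulAction (Fin m → Circle) M]
  [ContMDiffSMul (ModelWithCorners.pi fun _ : Fin m => 𝓡 1) 𝓘(ℝ, E) ∞ (Fin m → Circle) M]
  {k : ℕ} {R : ∀ x : M, TangentSpace 𝓘(ℝ, E) x}

/-- The periodic flow on `M` of the `j`-th circle of the torus. -/
noncomputable def circleFlow (M : Type*) [MulAction (Fin m → Circle) M] (j : Fin m) (t : ℝ) :
    M → M := fun x => torusCircle j t • x

omit [TopologicalSpace M] in
theorem circleFlow_zero (j : Fin m) : circleFlow M j 0 = id := by
  funext x; simp [circleFlow, torusCircle_zero]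

omit [TopologicalSpace M] in
theorem circleFlow_add (j : Fin m) (s t : ℝ) :
    circleFlow M j (s + t) = circleFlow M j s ∘ circleFlow M j t := by
  funext x; simp [circleFlow, torusCircle_add, mul_smul]

omit [TopologicalSpace M] in
theorem circleFlow_add_one (j : Fin m) (t : ℝ) : circleFlow M j (t + 1) = circleFlow M j t := by
  funext x; simp [circleFlow, torusCircle_add_one]

omit [IsManifold 𝓘(ℝ, E) ∞ M] in
theorem contMDiff_circleFlow (j : Fin m) : ContMDiff (𝓘(ℝ, ℝ).prod 𝓘(ℝ, E)) 𝓘(ℝ, E) ∞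
    fun p : ℝ × M => circleFlow M j p.1 p.2 :=
  (ContMDiffSMul.contMDiff_smul (I := ModelWithCorners.pi fun _ : Fin m => 𝓡 1)
    (I' := 𝓘(ℝ, E)) (n := ∞) (G := Fin m → Circle) (M := M)).comp
      (((contMDiff_torusCircle j).comp contMDiff_fst).prodMk contMDiff_snd)

theorem contMDiff_torus_smul (g : Fin m → Circle) :
    ContMDiff 𝓘(ℝ, E) 𝓘(ℝ, E) ∞ fun x : M => g • x :=
  contMDiff_smul_left (ModelWithCorners.pi fun _ : Fin m => 𝓡 1) (Fin m → Circle) g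

/-- Invariance under all circle factors implies invariance under the torus. -/
theorem mem_invariantForms_of_circles {α : smooth E M k}
    (h : ∀ (j : Fin m) t, pullback (circleFlow M j t) α.1 = α.1) :
    α ∈ (invariantForms (ModelWithCorners.pi fun _ : Fin m => 𝓡 1)
      (Fin m → Circle)).carrier k := by
  refine torus_induction ?_ (fun g g' hg hg' => ?_) fun j t => h j t
  · simp only [one_smul]
    exact pullback_id α.1
  · have h1 : (fun x : M => (g * g') • x) = (fun x => g • x) ∘ fun x => g' • x :=
      funext fun x => mul_smul g g' x
    rw [h1, ← pullback_pullback (contMDiff_torus_smul g) (contMDiff_torus_smul g'), hg, hg']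

/-- Averaging over a circle of the torus gives invariance under it and keeps the invariance under
the other circles, since the torus is commutative. -/
theorem pullback_circleFlow_average {α : smooth E M k} {s : Finset (Fin m)}
    (h : ∀ j ∈ s, ∀ t, pullback (circleFlow M j t) α.1 = α.1) (j : Fin m) :
    ∀ i ∈ insert j s, ∀ t, pullback (circleFlow M i t)
      (average (contMDiff_circleFlow (E := E) (M := M) j) α).1 =
        (average (contMDiff_circleFlow (E := E) (M := M) j) α).1 := by
  intro i hi t
  rcases Finset.mem_insert.1 hi with rfl | hi
  · exact pullback_average_self _ (circleFlow_add_one i) (circleFlow_add i) α t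
  · refine pullback_average _ (contMDiff_torus_smul (torusCircle i t)) (fun r => ?_) (h i hi t)
    funext x
    simp only [circleFlow, Function.comp_apply, ← mul_smul, mul_comm]

/-- Averaging a primitive over the circles of the torus one after the other. -/
theorem exists_invariant_primitive
    (hR : ∀ (g : Fin m → Circle) (x : M), mfderiv 𝓘(ℝ, E) 𝓘(ℝ, E) (g • ·) x (R x) = R (g • x))
    {α : smooth E M (k + 1)} (hα : ∀ (j : Fin m) t, pullback (circleFlow M j t) α.1 = α.1)
    {β : smooth E M k} (hβ : β.1.IsBasic R) (hd : dLin E M k β = α) (s : Finset (Fin m)) :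
    ∃ β' : smooth E M k, β'.1.IsBasic R ∧ dLin E M k β' = α ∧
      ∀ j ∈ s, ∀ t, pullback (circleFlow M j t) β'.1 = β'.1 := by
  induction s using Finset.induction_on with
  | empty => exact ⟨β, hβ, hd, by simp⟩
  | insert j s _ ih =>
    obtain ⟨β', h1, h2, h3⟩ := ih
    have hΦ := contMDiff_circleFlow (E := E) (M := M) j
    refine ⟨average hΦ β', isBasic_average hΦ (fun t x => hR _ x) h1, ?_, ?_⟩
    · rw [dLin_average, h2]
      exact average_eq_self hΦ (hα j)
    · exact pullback_circleFlow_average h3 j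

/-- Averaging a closed basic form over the circles of the torus one after the other, without
changing its basic cohomology class. -/
theorem exists_invariant_cohomologous
    (hR : ∀ (g : Fin m → Circle) (x : M), mfderiv 𝓘(ℝ, E) 𝓘(ℝ, E) (g • ·) x (R x) = R (g • x))
    {α : smooth E M (k + 1)} (hα : α.1.IsBasic R) (hd : dLin E M (k + 1) α = 0)
    (s : Finset (Fin m)) :
    ∃ (α' : smooth E M (k + 1)) (β : smooth E M k), α'.1.IsBasic R ∧ β.1.IsBasic R ∧
      dLin E M (k + 1) α' = 0 ∧ α' = α + dLin E M k β ∧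
        ∀ j ∈ s, ∀ t, pullback (circleFlow M j t) α'.1 = α'.1 := by
  induction s using Finset.induction_on with
  | empty =>
    exact ⟨α, 0, hα, ((basicForms R).carrier k).zero_mem, hd,
      by rw [map_zero, add_zero], by simp⟩
  | insert j s _ ih =>
    obtain ⟨α', β, h1, h2, hd', h3, h4⟩ := ih
    have hΦ := contMDiff_circleFlow (E := E) (M := M) j
    have hR' := fun (t : ℝ) (x : M) => hR (torusCircle j t) x
    refine ⟨average hΦ α', β + homotopy hΦ α', isBasic_average hΦ hR' h1,
      ((basicForms R).carrier k).add_mem h2 (isBasic_homotopy hΦ (circleFlow_zero j) hR' h1 hd'),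
      ?_, ?_, pullback_circleFlow_average h4 j⟩
    · rw [dLin_average, hd']
      exact average_eq_self hΦ fun _ => rfl
    · rw [average_eq_add_dLin_homotopy hΦ (circleFlow_zero j) hd', map_add, ← add_assoc, ← h3]

/-- Closed `0`-forms are locally constant, hence invariant under the connected torus. -/
theorem pullback_circleFlow_of_closed {α : smooth E M 0} (hd : dLin E M 0 α = 0) (j : Fin m)
    (t : ℝ) : pullback (circleFlow M j t) α.1 = α.1 := by
  rw [pullback_flow_eq_of_closed (contMDiff_circleFlow j) (smooth.isSmooth α)
    (congrArg Subtype.val hd) t, circleFlow_zero, pullback_id]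

end TorusAverage


theorem mainTheorem12 (n m : ℕ) {M : Type*} [TopologicalSpace M] [T2Space M] [CompactSpace M]
    [ChartedSpace (EuclideanSpace ℝ (Fin (2 * n + 1))) M] [IsManifold (𝓡 (2 * n + 1)) ∞ M]
    -- the torus `T = (S¹)^m` acts smoothly on `M`
    [MulAction (Fin m → Circle) M]
    [ContMDiffSMul (ModelWithCorners.pi fun _ : Fin m => 𝓡 1) (𝓡 (2 * n + 1)) ∞
      (Fin m → Circle) M]
    (η : FormField.smooth (EuclideanSpace ℝ (Fin (2 * n + 1))) M 1)
    (ω₂ : FormField.smooth (EuclideanSpace ℝ (Fin (2 * n + 1))) M 2)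
    (hcos : IsCosymplectic n η ω₂)
    (hT : IsCosymplecticAction (Fin m → Circle) η ω₂)
    (R : ∀ x : M, TangentSpace (𝓡 (2 * n + 1)) x)
    (hR : IsReebField η ω₂ R) :
    (DGAlgebra.Sub.inclusion
      (S := invariantForms (ModelWithCorners.pi fun _ : Fin m => 𝓡 1) (Fin m → Circle) ⊓
        basicForms R)
      (S' := basicForms R) (fun _ => inf_le_right)).IsQuasiIso := by
  have hR' : ∀ (g : Fin m → Circle) (x : M),
      mfderiv (𝓡 (2 * n + 1)) (𝓡 (2 * n + 1)) (g • ·) x (R x) = R (g • x) := fun g x =>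
    hR.mfderiv_apply (by simp) hcos (contMDiff_torus_smul g) (contMDiff_torus_smul g⁻¹)
      (funext fun y => smul_inv_smul g y) (funext fun y => inv_smul_smul g y) (hT g).1 (hT g).2 x
  refine DGAlgebra.Hom.isQuasiIso_of_elements _ ?_ ?_ ?_ ?_
  · exact fun a _ ha => Subtype.ext (congrArg (fun b : (basicForms R).carrier 0 => b.1) ha)
  · rintro k ⟨α, hα⟩ ⟨β, hβ⟩ - h
    obtain ⟨β', h1, h2, h3⟩ := exists_invariant_primitive hR' (α := α)
      (fun j t => hα.1 (torusCircle j t)) hβ (congrArg Subtype.val h).symm Finset.univ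
    exact ⟨⟨β', mem_invariantForms_of_circles fun j t => h3 j (Finset.mem_univ j) t, h1⟩,
      Subtype.ext h2⟩
  · rintro ⟨α, hα⟩ hd
    exact ⟨⟨α, mem_invariantForms_of_circles fun j t =>
      pullback_circleFlow_of_closed (congrArg Subtype.val hd) j t, hα⟩,
      Subtype.ext (congrArg (fun b : (basicForms R).carrier 1 => b.1) hd), rfl⟩
  · rintro k ⟨α, hα⟩ hd
    have hd' : FormField.dLin _ M (k + 1) α = 0 := congrArg Subtype.val hd
    obtain ⟨α', β, h1, h2, h3, h4, h5⟩ := exists_invariant_cohomologous hR' hα hd' Finset.univ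
    exact ⟨⟨α', mem_invariantForms_of_circles fun j t => h5 j (Finset.mem_univ j) t, h1⟩,
      ⟨β, h2⟩, Subtype.ext h3, Subtype.ext h4⟩
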